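/- Let $n\ge 4$, let $\mathfrak g$ be the simple Lie algebra of type $D_n$ with weight lattice $P=\bigoplus_{i=1}^n\mathbb Z\epsilon_i$, $(\epsilon_i|\epsilon_j)=\delta_{ij}$, simple roots $\alpha_i=\epsilon_i-\epsilon_{i+1}$ ($1\le i\le n-1$), $\alpha_n=\epsilon_{n-1}+\epsilon_n$, and positive roots $\epsilon_i\pm\epsilon_j$ ($i<j$). Let $\mathfrak l$ be the Levi subalgebra of type $A_{n-1}$ with simple roots $\alpha_1,\dots,\alpha_{n-1}$ and positive roots $\Phi_J=\{\epsilon_i-\epsilon_j\mid i<j\}$. Let $\mathbf B$ be the $\mathfrak g$-crystal of Lusztig data $\mathbf c=(c_\beta)_{\beta\in\Phi^+}$, $c_\beta\in\mathbb Z_{\ge0}$, with $\mathrm{wt}(\mathbf c)=-\sum_\beta c_\beta\beta$, associated to the reduced expression of the longest element of the Weyl group that corresponds to the convex order on $\Phi^+$ given by: $\epsilon_i+\epsilon_j\prec\epsilon_k-\epsilon_l$ always; $\epsilon_i+\epsilon_j\prec\epsilon_k+\epsilon_l$ iff $j>l$, or $j=l$ and $i>k$; $\epsilon_i-\epsilon_j\prec\epsilon_k-\epsilon_l$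 iff $j>l$, or $j=l$ and $i>k$. That is, $\varepsilon_i(\mathbf c)$ is the first entry of the Lusztig datum obtained from $\mathbf c$ by Lusztig's piecewise linear transition map to a reduced expression starting with $i$, and $\tilde f_i$ (resp. $\tilde e_i$) raises (resp. lowers, if it is positive) this entry by $1$. Let $\mathbf B_J\subset\mathbf B$ be the subcrystal of the $\mathbf c$ with $c_\beta=0$ for $\beta\notin\Phi_J$, regarded as a $\mathfrak g$-crystal by $\tilde e_n\mathbf c=\tilde f_n\mathbf c=\mathbf 0$, $\varepsilon_n(\mathbf c)=\varphi_n(\mathbf c)=-\infty$. Let $\mu=(\mu_1\ge\dots\ge\mu_n\ge0)$ be a partition with at most $n$ parts, and let $\mathbf S_\mu=SST_{[\overline n]}(\mu)$ be the set of semistandard tableaux of shape $\mu$ (rows weakly, columns strictly increasing) with entries in $\overline n<\dots<\overline 2<\overline 1$. It is an $\mathfrak l$-crystal in the usual way (through the reading word, columns from right to left and top to bottom in each column, with $\overline{i+1}\xrightarrow{\,i\,}\overline i$ and $\mathrm{wt}(\overline i)=-\epsilon_i$), and is regarded as a $\mathfrak g$-crystal by $\tilde e_nT=\tilde f_nT=\mathbf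 0$, $\varepsilon_n(T)=\varphi_n(T)=-\infty$. Put $\epsilon_\mu=-\sum_{r=1}^n\mu_r\epsilon_{n-r+1}$, and let $T_{\epsilon_\mu}=\{t_{\epsilon_\mu}\}$ be the crystal with $\mathrm{wt}(t_{\epsilon_\mu})=\epsilon_\mu$, $\tilde e_it_{\epsilon_\mu}=\tilde f_it_{\epsilon_\mu}=\mathbf 0$ and $\varepsilon_i(t_{\epsilon_\mu})=\varphi_i(t_{\epsilon_\mu})=-\infty$ for all $i$. For $T\in\mathbf S_\mu$ let $\mathbf c_J(T)\in\mathbf B_J$ be such that, for $1\le i<j\le n$, $c_{\epsilon_i-\epsilon_j}$ is the number of entries $\overline i$ in the $(n-j+1)$-th row (from the top) of $T$. Then the map $$\mathbf S_\mu\longrightarrow\mathbf B_J\otimes T_{\epsilon_\mu},\qquad T\longmapsto\mathbf c_J(T)\otimes t_{\epsilon_\mu}$$ is an embedding of $\mathfrak g$-crystals: both sides are crystals, and the map is injective, preserves $\mathrm{wt},\varepsilon_i,\varphi_i$, and satisfies $\psi(\tilde e_ib)=\tilde e_i\psi(b)$ whenever $\tilde e_ib\ne\mathbf 0$ and $\psi(\tilde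 f_ib)=\tilde f_i\psi(b)$ whenever $\tilde f_ib\neq\mathbf 0$. -/

import Mathlib

namespace CrystalD

/-! ## Weights and abstract crystals of type `D_n` -/

/-- The weight lattice `P = ⨁ ℤ ε_i`. Indices are zero-based: coordinate `k` of a weight is the
coefficient of `ε_{k+1}`. -/
abbrev Weight (n : ℕ) := Fin n → ℤ

/-- The vector `ε_{k+1}`. -/
def eps (n k : ℕ) : Weight n := fun m => if (m : ℕ) = k then 1 else 0

/-- The simple root `α_{i+1}`: it is `ε_{i+1} - ε_{i+2}` for `i + 1 < n`, and
`α_n = ε_{n-1} + ε_n` for the last index. -/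
def simpleRootVec {n : ℕ} (i : Fin n) : Weight n :=
  if (i : ℕ) + 1 < n then eps n i - eps n (i + 1) else eps n (n - 2) + eps n (n - 1)

/-- The pairing `⟨h_i, w⟩` of a simple coroot with a weight; type `D` being simply laced, it is
`(α_i | w)` for the form with `(ε_i | ε_j) = δ_{ij}`. -/
def corootPairing {n : ℕ} (i : Fin n) (w : Weight n) : ℤ := ∑ k, simpleRootVec i k * w k

/-- The data of a crystal: a set with the maps `wt`, `ε_i`, `φ_i` (values in `ℤ ∪ {-∞}`) and the
operators `ẽ_i`, `f̃_i` (where `none` is the formal symbol `𝟎`). -/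
structure CrystalData (n : ℕ) where
  carrier : Type
  wt : carrier → Weight n
  ε : Fin n → carrier → WithBot ℤ
  φ : Fin n → carrier → WithBot ℤ
  e : Fin n → carrier → Option carrier
  f : Fin n → carrier → Option carrier

/-- Kashiwara's axioms of a (type `D_n`) crystal. -/
structure CrystalData.IsCrystal {n : ℕ} (X : CrystalData n) : Prop where
  phi_eq : ∀ i b, X.φ i b = X.ε i b + ((corootPairing i (X.wt b) : ℤ) : WithBot ℤ)
  wt_e : ∀ i b b', X.e i b = some b' → X.wt b' = X.wt b + simpleRootVec i
  eps_e : ∀ i b b', X.e i b = some b' → X.ε i b = X.ε i b' + 1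
  phi_e : ∀ i b b', X.e i b = some b' → X.φ i b' = X.φ i b + 1
  wt_f : ∀ i b b', X.f i b = some b' → X.wt b' = X.wt b - simpleRootVec i
  eps_f : ∀ i b b', X.f i b = some b' → X.ε i b' = X.ε i b + 1
  phi_f : ∀ i b b', X.f i b = some b' → X.φ i b = X.φ i b' + 1
  f_iff_e : ∀ i b b', X.f i b = some b' ↔ X.e i b' = some b
  of_phi_bot : ∀ i b, X.φ i b = ⊥ → X.e i b = none ∧ X.f i b = none

/-- A map `ψ : X → Y` (sending `𝟎` to `𝟎`) is an embedding of crystals if it is injective, preserves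
`wt`, `ε_i`, `φ_i`, and commutes with `ẽ_i` and `f̃_i` wherever these are nonzero on `X`. -/
structure IsCrystalEmbedding {n : ℕ} (X Y : CrystalData n) (ψ : X.carrier → Y.carrier) :
    Prop where
  injective : Function.Injective ψ
  wt_eq : ∀ b, Y.wt (ψ b) = X.wt b
  eps_eq : ∀ i b, Y.ε i (ψ b) = X.ε i b
  phi_eq : ∀ i b, Y.φ i (ψ b) = X.φ i b
  map_e : ∀ i b b', X.e i b = some b' → Y.e i (ψ b) = some (ψ b')
  map_f : ∀ i b b', X.f i b = some b' → Y.f i (ψ b) = some (ψ b')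

/-- The crystal `T_w = {t_w}`. -/
def trivialCrystal {n : ℕ} (w : Weight n) : CrystalData n where
  carrier := Unit
  wt _ := w
  ε _ _ := ⊥
  φ _ _ := ⊥
  e _ _ := none
  f _ _ := none

/-- The tensor product of crystals, in Kashiwara's convention. -/
noncomputable def tensor {n : ℕ} (X Y : CrystalData n) : CrystalData n where
  carrier := X.carrier × Y.carrier
  wt b := X.wt b.1 + Y.wt b.2
  ε i b := max (X.ε i b.1) (Y.ε i b.2 + ((-corootPairing i (X.wt b.1) : ℤ) : WithBot ℤ))
  φ i b := max (X.φ i b.1 + ((corootPairing i (Y.wt b.2) : ℤ) : WithBot ℤ)) (Y.φ i b.2)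
  e i b := if Y.ε i b.2 ≤ X.φ i b.1 then (X.e i b.1).map (fun x => (x, b.2))
    else (Y.e i b.2).map (fun y => (b.1, y))
  f i b := if Y.ε i b.2 < X.φ i b.1 then (X.f i b.1).map (fun x => (x, b.2))
    else (Y.f i b.2).map (fun y => (b.1, y))

/-! ## The crystal of Lusztig data -/

/-- The positive roots of type `D_n`: `Sum.inl (i, j)` is `ε_{i+1} + ε_{j+1}` and
`Sum.inr (i, j)` is `ε_{i+1} - ε_{j+1}`, for `i < j`. -/
abbrev PosRoot (n : ℕ) := {p : Fin n × Fin n // p.1 < p.2} ⊕ {p : Fin n × Fin n // p.1 < p.2}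

/-- The root `ε_{i+1} + ε_{j+1}`. -/
abbrev sumRoot {n : ℕ} (i j : Fin n) (h : i < j) : PosRoot n := Sum.inl ⟨(i, j), h⟩

/-- The root `ε_{i+1} - ε_{j+1}`. -/
abbrev diffRoot {n : ℕ} (i j : Fin n) (h : i < j) : PosRoot n := Sum.inr ⟨(i, j), h⟩

/-- A positive root as a vector. -/
def PosRoot.vec {n : ℕ} : PosRoot n → Weight n
  | Sum.inl p => eps n p.1.1 + eps n p.1.2
  | Sum.inr p => eps n p.1.1 - eps n p.1.2

/-- The simple root `α_{i+1}` as a positive root. -/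
def simpleRoot {n : ℕ} (hn : 2 ≤ n) (i : Fin n) : PosRoot n :=
  if h : (i : ℕ) + 1 < n then diffRoot i ⟨i + 1, h⟩ (Fin.mk_lt_mk.2 (Nat.lt_succ_self i))
  else sumRoot ⟨n - 2, by omega⟩ ⟨n - 1, by omega⟩ (Fin.mk_lt_mk.2 (by omega))

/-- Lusztig data: a multiplicity for each positive root. This is the set `𝐁`. -/
abbrev LusztigDatum (n : ℕ) := PosRoot n → ℕ

/-- Lusztig's piecewise linear transition map attached to a braid move. When the consecutive
roots `α, γ = α + β, β` of a convex order are reversed into `β, γ, α`, the multiplicities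
`(a, c, b)` of `(α, γ, β)` are replaced by `(a + c - m, m, b + c - m)` where `m = min a b`, the
multiplicities still being attached to `(α, γ, β)`. The map is an involution, and is also the
transition map of the inverse braid move. (Exchanging two consecutive orthogonal roots does not
change the multiplicities, when these are indexed by roots.) -/
def braidMove {n : ℕ} (t : PosRoot n × PosRoot n × PosRoot n) (c : LusztigDatum n) :
    LusztigDatum n := fun r =>
  if r = t.1 then c t.1 + c t.2.1 - min (c t.1) (c t.2.2)
  else if r = t.2.1 then min (c t.1) (c t.2.2)
  else if r = t.2.2 then c t.2.2 + c t.2.1 - min (c t.1) (c t.2.2)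
  else c r

/-- The triples `(ε_q - ε_k, ε_p - ε_k, ε_p - ε_q)` for `k = q + 1, …, n` in this order. -/
def diffTriples {n : ℕ} (p q : Fin n) (hpq : p < q) :
    List (PosRoot n × PosRoot n × PosRoot n) :=
  (List.finRange n).filterMap fun k =>
    if h : q < k then some (diffRoot q k h, diffRoot p k (hpq.trans h), diffRoot p q hpq) else none

/-- The triples `(ε_k + ε_q, ε_k + ε_p, ε_p - ε_q)` for `k = 1, …, p - 1` in this order. -/
def lowTriples {n : ℕ} (p q : Fin n) (hpq : p < q) :
    List (PosRoot n × PosRoot n × PosRoot n) :=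
  (List.finRange n).filterMap fun k =>
    if h : k < p then some (sumRoot k q (h.trans hpq), sumRoot k p h, diffRoot p q hpq) else none

/-- The triples `(ε_q + ε_k, ε_p + ε_k, ε_p - ε_q)` for `k = q + 1, …, n` in this order. -/
def highTriples {n : ℕ} (p q : Fin n) (hpq : p < q) :
    List (PosRoot n × PosRoot n × PosRoot n) :=
  (List.finRange n).filterMap fun k =>
    if h : q < k then some (sumRoot q k h, sumRoot p k (hpq.trans h), diffRoot p q hpq) else none

/-- The reduced expression `𝐢₀` of the longest element is the one whose convex order is
* `ε_i + ε_j ≺ ε_k - ε_l` always,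
* `ε_i + ε_j ≺ ε_k + ε_l` iff `j > l`, or `j = l` and `i > k`,
* `ε_i - ε_j ≺ ε_k - ε_l` iff `j > l`, or `j = l` and `i > k`.

For each simple root `α_i`, this is the list of braid moves, applied in the order of the list and
interspersed with exchanges of consecutive orthogonal roots, that leads from this convex order to
one whose first root is `α_i`. For `i < n` the root `α_i = ε_i - ε_{i+1}` is moved to the left, past
each of the pairs of roots `(β, β + α_i)` that precede it; for `i = n` the root `α_n` is the first
one already. -/
def toFront {n : ℕ} (i : Fin n) : List (PosRoot n × PosRoot n × PosRoot n) :=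
  if h : (i : ℕ) + 1 < n then
    have hlt : i < ⟨i + 1, h⟩ := Fin.mk_lt_mk.2 (Nat.lt_succ_self i)
    diffTriples i ⟨i + 1, h⟩ hlt ++ lowTriples i ⟨i + 1, h⟩ hlt ++ highTriples i ⟨i + 1, h⟩ hlt
  else []

/-- The transition map from `𝐢₀`-Lusztig data to the Lusztig data for a reduced expression that
starts with `i`. -/
def transition {n : ℕ} (i : Fin n) (c : LusztigDatum n) : LusztigDatum n :=
  (toFront i).foldl (fun d t => braidMove t d) c

/-- The inverse transition map: the same braid moves in the opposite order. -/
def transitionInv {n : ℕ} (i : Fin n) (c : LusztigDatum n) : LusztigDatum n :=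
  (toFront i).reverse.foldl (fun d t => braidMove t d) c

/-- The weight `-∑ c_β β` of a Lusztig datum. -/
def LusztigDatum.wt {n : ℕ} (c : LusztigDatum n) : Weight n := -∑ r, (c r : ℤ) • PosRoot.vec r

/-- `ε_i` is the multiplicity of `α_i` in the Lusztig datum for a reduced expression that starts
with `i`. -/
def lusztigEps {n : ℕ} (hn : 2 ≤ n) (i : Fin n) (c : LusztigDatum n) : ℕ :=
  transition i c (simpleRoot hn i)

/-- `f̃_i` raises the first multiplicity of the Lusztig datum for a reduced expression that starts
with `i`. -/
def lusztigF {n : ℕ} (hn : 2 ≤ n) (i : Fin n) (c : LusztigDatum n) : LusztigDatum n :=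
  transitionInv i (Function.update (transition i c) (simpleRoot hn i) (lusztigEps hn i c + 1))

/-- `ẽ_i` lowers the same multiplicity; this is used where `ε_i` is positive. -/
def lusztigE {n : ℕ} (hn : 2 ≤ n) (i : Fin n) (c : LusztigDatum n) : LusztigDatum n :=
  transitionInv i (Function.update (transition i c) (simpleRoot hn i) (lusztigEps hn i c - 1))

/-- The crystal `𝐁` of Lusztig data associated to `𝐢₀`. -/
def lusztigCrystal {n : ℕ} (hn : 2 ≤ n) : CrystalData n where
  carrier := LusztigDatum n
  wt c := c.wt
  ε i c := ((lusztigEps hn i c : ℤ) : WithBot ℤ)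
  φ i c := ((lusztigEps hn i c + corootPairing i c.wt : ℤ) : WithBot ℤ)
  e i c := if lusztigEps hn i c = 0 then none else some (lusztigE hn i c)
  f i c := some (lusztigF hn i c)

/-- `c_β = 0` unless `β` is a root of the Levi subalgebra `𝔩`, that is, of the form
`ε_i - ε_j`. -/
def IsLevi {n : ℕ} (c : LusztigDatum n) : Prop := ∀ p, c (Sum.inl p) = 0

theorem toFront_isLevi {n : ℕ} {i : Fin n} {t : PosRoot n × PosRoot n × PosRoot n}
    (ht : t ∈ toFront i) {c : LusztigDatum n} (hc : IsLevi c) : IsLevi (braidMove t c) := by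
  have key : (∃ a b d, t = (Sum.inr a, Sum.inr b, Sum.inr d)) ∨
      ∃ a b d, t = (Sum.inl a, Sum.inl b, Sum.inr d) := by
    unfold toFront at ht
    split_ifs at ht with h
    · simp only [List.mem_append, diffTriples, lowTriples, highTriples, List.mem_filterMap] at ht
      rcases ht with (⟨k, -, hk⟩ | ⟨k, -, hk⟩) | ⟨k, -, hk⟩
      · split_ifs at hk
        exact Or.inl ⟨_, _, _, (Option.some.inj hk).symm⟩
      · split_ifs at hk
        exact Or.inr ⟨_, _, _, (Option.some.inj hk).symm⟩
      · split_ifs at hk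
        exact Or.inr ⟨_, _, _, (Option.some.inj hk).symm⟩
    · simp at ht
  intro p
  have hp := hc p
  rcases key with ⟨a, b, d, rfl⟩ | ⟨a, b, d, rfl⟩
  · simp [braidMove, hp]
  · have ha := hc a
    have hb := hc b
    simp [braidMove, hp, ha, hb]

theorem foldl_isLevi {n : ℕ} {i : Fin n} (l : List (PosRoot n × PosRoot n × PosRoot n)) :
    (∀ t ∈ l, t ∈ toFront i) → ∀ {c : LusztigDatum n}, IsLevi c →
      IsLevi (l.foldl (fun d t => braidMove t d) c) := by
  induction l with
  | nil => intro _ c hc; exact hc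
  | cons t l ih =>
    intro hl c hc
    exact ih (fun s hs => hl s (List.mem_cons_of_mem _ hs))
      (toFront_isLevi (hl t List.mem_cons_self) hc)

theorem isLevi_update {n : ℕ} (hn : 2 ≤ n) {i : Fin n} (hi : (i : ℕ) + 1 < n)
    {c : LusztigDatum n} (hc : IsLevi c) (k : ℕ) :
    IsLevi (transitionInv i (Function.update (transition i c) (simpleRoot hn i) k)) := by
  refine foldl_isLevi (i := i) _ (fun t ht => List.mem_reverse.1 ht) ?_
  intro p
  have h := foldl_isLevi (i := i) (toFront i) (fun t ht => ht) hc p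
  have hne : (Sum.inl p : PosRoot n) ≠ simpleRoot hn i := by simp [simpleRoot, hi]
  rw [Function.update_of_ne hne]
  exact h

/-- The subcrystal `𝐁_J` of `𝐁` of the Lusztig data supported on the roots of `𝔩`, where
`ẽ_n`, `f̃_n` are trivial and `ε_n = φ_n = -∞`. -/
def leviCrystal {n : ℕ} (hn : 2 ≤ n) : CrystalData n where
  carrier := {c : LusztigDatum n // IsLevi c}
  wt c := c.1.wt
  ε i c := if (i : ℕ) + 1 < n then (lusztigCrystal hn).ε i c.1 else ⊥
  φ i c := if (i : ℕ) + 1 < n then (lusztigCrystal hn).φ i c.1 else ⊥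
  e i c := if hi : (i : ℕ) + 1 < n then
      if lusztigEps hn i c.1 = 0 then none
      else some ⟨lusztigE hn i c.1, isLevi_update hn hi c.2 _⟩
    else none
  f i c := if hi : (i : ℕ) + 1 < n then some ⟨lusztigF hn i c.1, isLevi_update hn hi c.2 _⟩
    else none

/-! ## The crystal of semistandard tableaux -/

section Signature

variable {α : Type*}

/-- Given a sequence of signs `s`, read along the list, in which the neighbouring pairs `(+, -)` are
cancelled as far as possible (ignoring the zeros), the number of the remaining signs `-`. -/
def unmatchedNeg (s : α → SignType) : List α → ℕ
  | [] => 0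
  | a :: l =>
    if s a = 1 then unmatchedNeg s l - 1
    else if s a = -1 then unmatchedNeg s l + 1
    else unmatchedNeg s l

/-- The position of the leftmost `+` that remains after this cancellation: it is the first `+` such
that in the sequence to the right of it no `-` remains. -/
def firstUnmatchedPos (s : α → SignType) : List α → Option α
  | [] => none
  | a :: l => if s a = 1 ∧ unmatchedNeg s l = 0 then some a else firstUnmatchedPos s l

/-- The number of the remaining signs `+`, by reading backwards with the opposite signs. -/
def unmatchedPos (s : α → SignType) (l : List α) : ℕ := unmatchedNeg (fun a => -s a) l.reverse

/-- The position of the rightmost remaining `-`. -/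
def lastUnmatchedNeg (s : α → SignType) (l : List α) : Option α :=
  firstUnmatchedPos (fun a => -s a) l.reverse

theorem firstUnmatchedPos_spec {s : α → SignType} {l : List α} {a : α}
    (h : firstUnmatchedPos s l = some a) :
    ∃ A B, l = A ++ a :: B ∧ s a = 1 ∧ unmatchedNeg s B = 0 ∧
      ∀ A₁ A₂ b, A = A₁ ++ b :: A₂ → s b = 1 → unmatchedNeg s (A₂ ++ a :: B) ≠ 0 := by
  induction l with
  | nil => simp [firstUnmatchedPos] at h
  | cons x l ih =>
    unfold firstUnmatchedPos at h
    split_ifs at h with hx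
    · obtain rfl := Option.some.inj h
      exact ⟨[], l, rfl, hx.1, hx.2, fun A₁ A₂ b hA => by simp at hA⟩
    · obtain ⟨A, B, rfl, h1, h2, h3⟩ := ih h
      refine ⟨x :: A, B, rfl, h1, h2, ?_⟩
      intro A₁ A₂ b hA hb
      cases A₁ with
      | nil =>
        obtain ⟨rfl, rfl⟩ := List.cons.inj hA
        exact fun h0 => hx ⟨hb, h0⟩
      | cons y A₁ => exact h3 A₁ A₂ b (List.cons.inj hA).2 hb

theorem unmatchedNeg_append_le {s : α → SignType} {l l' : List α} (h : ∀ a ∈ l, s a ≠ -1) :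
    unmatchedNeg s (l ++ l') ≤ unmatchedNeg s l' := by
  induction l with
  | nil => exact le_rfl
  | cons x l ih =>
    have h1 := ih (fun a ha => h a (List.mem_cons_of_mem _ ha))
    have h2 := h x List.mem_cons_self
    simp only [List.cons_append, unmatchedNeg, h2, if_false]
    split_ifs <;> omega

/-- In a list that is sorted by a relation, a selected `+` is not followed by a `-` with only
nonnegative signs in between. -/
theorem firstUnmatchedPos_right {R : α → α → Prop} {s : α → SignType} {l : List α} {a d : α}
    (hl : l.Pairwise R) (hR : ∀ x y, R x y → ¬ R y x)
    (h : firstUnmatchedPos s l = some a) (hd : d ∈ l) (had : R a d) (hs : s d = -1)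
    (hbet : ∀ m, ¬ (R a m ∧ R m d)) : False := by
  obtain ⟨A, B, rfl, h1, h2, -⟩ := firstUnmatchedPos_spec h
  rw [List.pairwise_append, List.pairwise_cons] at hl
  obtain ⟨-, ⟨haB, hB⟩, hAB⟩ := hl
  have hdB : d ∈ B := by
    rcases List.mem_append.1 hd with hd | hd
    · exact (hR _ _ had (hAB d hd a List.mem_cons_self)).elim
    · rcases List.mem_cons.1 hd with rfl | hd
      · exact (hR _ _ had had).elim
      · exact hd
  cases B with
  | nil => simp at hdB
  | cons y B =>
    rcases List.mem_cons.1 hdB with rfl | hdB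
    · simp [unmatchedNeg, hs] at h2
    · rw [List.pairwise_cons] at hB
      exact hbet y ⟨haB y List.mem_cons_self, hB.1 d hdB⟩

/-- A selected `+` is not preceded by another `+` with no `-` in between. -/
theorem firstUnmatchedPos_left {R : α → α → Prop} {s : α → SignType} {l : List α} {a b : α}
    (hl : l.Pairwise R) (hR : ∀ x y, R x y → ¬ R y x)
    (h : firstUnmatchedPos s l = some a) (hb : b ∈ l) (hba : R b a) (hs : s b = 1)
    (hbet : ∀ m ∈ l, R b m → R m a → s m ≠ -1) : False := by
  obtain ⟨A, B, rfl, h1, h2, h3⟩ := firstUnmatchedPos_spec h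
  have hl' := hl
  rw [List.pairwise_append, List.pairwise_cons] at hl
  obtain ⟨hA, ⟨haB, -⟩, hAB⟩ := hl
  have hbA : b ∈ A := by
    rcases List.mem_append.1 hb with hb | hb
    · exact hb
    · rcases List.mem_cons.1 hb with rfl | hb
      · exact (hR _ _ hba hba).elim
      · exact (hR _ _ hba (haB b hb)).elim
  obtain ⟨A₁, A₂, rfl⟩ := List.append_of_mem hbA
  refine h3 A₁ A₂ b rfl hs ?_
  rw [List.pairwise_append, List.pairwise_cons] at hA
  have hle : unmatchedNeg s (A₂ ++ a :: B) ≤ unmatchedNeg s (a :: B) := by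
    refine unmatchedNeg_append_le fun m hm => hbet m ?_ (hA.2.1.1 m hm) ?_
    · simp [hm]
    · exact hAB m (by simp [hm]) a List.mem_cons_self
  have h0 : unmatchedNeg s (a :: B) = 0 := by simp [unmatchedNeg, h1, h2]
  omega

end Signature

/-- The order in which the cells of a diagram are read: column by column from right to left, and
from top to bottom in each column. -/
def readsBefore (x y : ℕ × ℕ) : Prop := y.2 < x.2 ∨ (x.2 = y.2 ∧ x.1 < y.1)

/-- The list of the cells of `μ` in reading order. Cells are pairs (row, column), from zero. -/
def readingCells (μ : YoungDiagram) : List (ℕ × ℕ) :=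
  (List.range (μ.rowLen 0)).reverse.flatMap fun j =>
    (List.range (μ.colLen j)).map fun i => (i, j)

theorem mem_readingCells {μ : YoungDiagram} {x : ℕ × ℕ} : x ∈ readingCells μ ↔ x ∈ μ := by
  obtain ⟨i, j⟩ := x
  simp only [readingCells, List.mem_flatMap, List.mem_reverse, List.mem_range, List.mem_map,
    Prod.mk.injEq]
  constructor
  · rintro ⟨j', -, i', h, rfl, rfl⟩
    exact YoungDiagram.mem_iff_lt_colLen.2 h
  · intro h
    exact ⟨j, YoungDiagram.mem_iff_lt_rowLen.1 (μ.up_left_mem (Nat.zero_le i) le_rfl h), i,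
      YoungDiagram.mem_iff_lt_colLen.1 h, rfl, rfl⟩

theorem readingCells_pairwise (μ : YoungDiagram) : (readingCells μ).Pairwise readsBefore := by
  unfold readingCells
  rw [List.pairwise_flatMap]
  constructor
  · intro j _
    rw [List.pairwise_map]
    exact List.pairwise_lt_range.imp fun h => Or.inr ⟨rfl, h⟩
  · rw [List.pairwise_reverse]
    refine List.pairwise_lt_range.imp ?_
    intro a b hab x hx y hy
    obtain ⟨_, _, rfl⟩ := List.mem_map.1 hx
    obtain ⟨_, _, rfl⟩ := List.mem_map.1 hy
    exact Or.inl hab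

/-- The set `𝐒_μ = SST_{[n̄]}(μ)`. The ordered alphabet `n̄ < ⋯ < 2̄ < 1̄` is identified with
`0 < 1 < ⋯ < n - 1`: the entry `v` stands for the letter whose unbarred value is `n - v`. -/
def BarTableau (n : ℕ) (μ : YoungDiagram) :=
  {T : SemistandardYoungTableau μ // ∀ i j, (i, j) ∈ μ → T i j < n}

namespace BarTableau

variable {n : ℕ} {μ : YoungDiagram}

/-- The entry in row `i` and column `j`. -/
abbrev entry (T : BarTableau n μ) (i j : ℕ) : ℕ := T.1 i j

/-- The signs for `α_{i+1}`, `i + 1 < n`: the letter with a bar over `i + 2` has the sign `+`, and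
the letter with a bar over `i + 1` has the sign `-`. -/
def sign (T : BarTableau n μ) (i : Fin n) (x : ℕ × ℕ) : SignType :=
  if T.entry x.1 x.2 + i + 2 = n then 1 else if T.entry x.1 x.2 + i + 1 = n then -1 else 0

/-- Replacing one entry. -/
def setEntry (T : BarTableau n μ) (x : ℕ × ℕ) (v : ℕ) (hx : x ∈ μ) (hv : v < n)
    (h1 : ∀ j < x.2, T.entry x.1 j ≤ v) (h2 : ∀ j, x.2 < j → (x.1, j) ∈ μ → v ≤ T.entry x.1 j)
    (h3 : ∀ i < x.1, T.entry i x.2 < v) (h4 : ∀ i, x.1 < i → (i, x.2) ∈ μ → v < T.entry i x.2) :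
    BarTableau n μ :=
  ⟨{ entry := fun i j => if (i, j) = x then v else T.entry i j
     row_weak' := by
      intro i j1 j2 hj hm
      split_ifs with ha hb hb
      · exact le_rfl
      · subst ha; exact h2 _ hj hm
      · subst hb; exact h1 _ hj
      · exact T.1.row_weak hj hm
     col_strict' := by
      intro i1 i2 j hi hm
      split_ifs with ha hb hb
      · subst ha; simp at hb; omega
      · subst ha; exact h4 _ hi hm
      · subst hb; exact h3 _ hi
      · exact T.1.col_strict hi hm
     zeros' := by
      intro i j hm
      have hne : (i, j) ≠ x := by rintro rfl; exact hm hx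
      rw [if_neg hne]
      exact T.1.zeros hm },
    by
      intro i j hm
      change (if (i, j) = x then v else T.entry i j) < n
      split_ifs
      · exact hv
      · exact T.2 i j hm⟩

theorem sign_eq_one_iff {T : BarTableau n μ} {i : Fin n} {x : ℕ × ℕ} :
    T.sign i x = 1 ↔ T.entry x.1 x.2 + i + 2 = n := by
  unfold sign
  split_ifs with h1 h2
  · exact ⟨fun _ => h1, fun _ => rfl⟩
  · exact ⟨fun h => absurd h (by decide), fun h => absurd h h1⟩
  · exact ⟨fun h => absurd h (by decide), fun h => absurd h h1⟩

theorem sign_eq_neg_one_iff {T : BarTableau n μ} {i : Fin n} {x : ℕ × ℕ} :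
    T.sign i x = -1 ↔ T.entry x.1 x.2 + i + 1 = n := by
  unfold sign
  split_ifs with h1 h2
  · exact ⟨fun h => absurd h (by decide), fun h => by omega⟩
  · exact ⟨fun _ => h2, fun _ => rfl⟩
  · exact ⟨fun h => absurd h (by decide), fun h => absurd h h2⟩

theorem neg_sign_eq_one_iff {T : BarTableau n μ} {i : Fin n} {x : ℕ × ℕ} :
    -T.sign i x = 1 ↔ T.entry x.1 x.2 + i + 1 = n := by
  rw [← sign_eq_neg_one_iff]
  cases T.sign i x <;> decide

theorem neg_sign_eq_neg_one_iff {T : BarTableau n μ} {i : Fin n} {x : ℕ × ℕ} :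
    -T.sign i x = -1 ↔ T.entry x.1 x.2 + i + 2 = n := by
  rw [← sign_eq_one_iff]
  cases T.sign i x <;> decide

theorem readsBefore_asymm (x y : ℕ × ℕ) (h : readsBefore x y) : ¬ readsBefore y x := by
  unfold readsBefore at *
  omega

theorem raise_spec (T : BarTableau n μ) (i : Fin n) (x : ℕ × ℕ)
    (h : firstUnmatchedPos (T.sign i) (readingCells μ) = some x) :
    x ∈ μ ∧ T.entry x.1 x.2 + 1 < n ∧ (∀ j < x.2, T.entry x.1 j ≤ T.entry x.1 x.2 + 1) ∧
      (∀ j, x.2 < j → (x.1, j) ∈ μ → T.entry x.1 x.2 + 1 ≤ T.entry x.1 j) ∧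
      (∀ r < x.1, T.entry r x.2 < T.entry x.1 x.2 + 1) ∧
      (∀ r, x.1 < r → (r, x.2) ∈ μ → T.entry x.1 x.2 + 1 < T.entry r x.2) := by
  have hpw := readingCells_pairwise μ
  have hx1 : T.sign i x = 1 ∧ x ∈ μ := by
    obtain ⟨A, B, hAB, h1, -⟩ := firstUnmatchedPos_spec h
    exact ⟨h1, mem_readingCells.1 (by rw [hAB]; simp)⟩
  have hval := sign_eq_one_iff.1 hx1.1
  have hbelow : ∀ r, x.1 < r → (r, x.2) ∈ μ → T.entry x.1 x.2 + 1 < T.entry r x.2 := by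
    intro r hr hm
    have hm' : (x.1 + 1, x.2) ∈ μ := μ.up_left_mem hr le_rfl hm
    have hlt : T.entry x.1 x.2 < T.entry (x.1 + 1) x.2 := T.1.col_strict (Nat.lt_succ_self _) hm'
    have hle : T.entry (x.1 + 1) x.2 ≤ T.entry r x.2 := T.1.col_weak hr hm
    by_contra hcon
    refine firstUnmatchedPos_right hpw readsBefore_asymm h (d := (x.1 + 1, x.2))
      (mem_readingCells.2 hm') (Or.inr ⟨rfl, Nat.lt_succ_self _⟩) ?_ ?_
    · refine sign_eq_neg_one_iff.2 ?_
      simp only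
      omega
    · rintro m ⟨hm1, hm2⟩
      simp only [readsBefore] at hm1 hm2
      omega
  refine ⟨hx1.2, by omega, ?_, ?_, ?_, hbelow⟩
  · intro j hj
    have : T.entry x.1 j ≤ T.entry x.1 x.2 := T.1.row_weak hj hx1.2
    omega
  · intro j hj hm
    have hm' : (x.1, x.2 + 1) ∈ μ := μ.up_left_mem le_rfl hj hm
    have hle : T.entry x.1 x.2 ≤ T.entry x.1 (x.2 + 1) := T.1.row_weak (Nat.lt_succ_self _) hm'
    have hle' : T.entry x.1 (x.2 + 1) ≤ T.entry x.1 j := T.1.row_weak_of_le hj hm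
    by_contra hcon
    refine firstUnmatchedPos_left hpw readsBefore_asymm h (b := (x.1, x.2 + 1))
      (mem_readingCells.2 hm') (Or.inl (Nat.lt_succ_self _)) ?_ ?_
    · refine sign_eq_one_iff.2 ?_
      simp only
      omega
    · rintro ⟨r, c⟩ hm1 hm2 hm3 hs
      have hrc := mem_readingCells.1 hm1
      have hv := sign_eq_neg_one_iff.1 hs
      simp only [readsBefore] at hm2 hm3 hv
      by_cases hc : c = x.2
      · subst hc
        have : T.entry r x.2 < T.entry x.1 x.2 := T.1.col_strict (by omega) hx1.2
        omega
      · have hc' : c = x.2 + 1 := by omega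
        subst hc'
        have hmr : (r, x.2) ∈ μ := μ.up_left_mem le_rfl (Nat.le_succ _) hrc
        have h1 := hbelow r (by omega) hmr
        have h2 : T.entry r x.2 ≤ T.entry r (x.2 + 1) := T.1.row_weak (Nat.lt_succ_self _) hrc
        omega
  · intro r hr
    have : T.entry r x.2 < T.entry x.1 x.2 := T.1.col_strict hr hx1.2
    omega

theorem lower_spec (T : BarTableau n μ) (i : Fin n) (hi : (i : ℕ) + 1 < n) (x : ℕ × ℕ)
    (h : lastUnmatchedNeg (T.sign i) (readingCells μ) = some x) :
    x ∈ μ ∧ T.entry x.1 x.2 - 1 < n ∧ (∀ j < x.2, T.entry x.1 j ≤ T.entry x.1 x.2 - 1) ∧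
      (∀ j, x.2 < j → (x.1, j) ∈ μ → T.entry x.1 x.2 - 1 ≤ T.entry x.1 j) ∧
      (∀ r < x.1, T.entry r x.2 < T.entry x.1 x.2 - 1) ∧
      (∀ r, x.1 < r → (r, x.2) ∈ μ → T.entry x.1 x.2 - 1 < T.entry r x.2) := by
  have hpw : (readingCells μ).reverse.Pairwise (fun a b => readsBefore b a) :=
    List.pairwise_reverse.2 (readingCells_pairwise μ)
  have hasymm : ∀ a b : ℕ × ℕ, readsBefore b a → ¬ readsBefore a b :=
    fun a b => readsBefore_asymm b a
  have hmem : ∀ y, y ∈ (readingCells μ).reverse ↔ y ∈ μ := fun y => by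
    rw [List.mem_reverse, mem_readingCells]
  unfold lastUnmatchedNeg at h
  have hx1 : -T.sign i x = 1 ∧ x ∈ μ := by
    obtain ⟨A, B, hAB, h1, -⟩ := firstUnmatchedPos_spec h
    exact ⟨h1, (hmem x).1 (by rw [hAB]; simp)⟩
  have hval := neg_sign_eq_one_iff.1 hx1.1
  have habove : ∀ r, r < x.1 → T.entry r x.2 < T.entry x.1 x.2 - 1 := by
    intro r hr
    have hm' : (x.1 - 1, x.2) ∈ μ := μ.up_left_mem (Nat.sub_le _ _) le_rfl hx1.2
    have hlt : T.entry (x.1 - 1) x.2 < T.entry x.1 x.2 := T.1.col_strict (by omega) hx1.2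
    have hle : T.entry r x.2 ≤ T.entry (x.1 - 1) x.2 := T.1.col_weak (by omega) hm'
    by_contra hcon
    refine firstUnmatchedPos_right hpw hasymm h (d := (x.1 - 1, x.2))
      ((hmem _).2 hm') (Or.inr ⟨rfl, by simp only; omega⟩) ?_ ?_
    · refine neg_sign_eq_neg_one_iff.2 ?_
      simp only
      omega
    · rintro m ⟨hm1, hm2⟩
      simp only [readsBefore] at hm1 hm2
      omega
  refine ⟨hx1.2, by omega, ?_, ?_, habove, ?_⟩
  · intro j hj
    have hm' : (x.1, x.2 - 1) ∈ μ := μ.up_left_mem le_rfl (Nat.sub_le _ _) hx1.2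
    have hle : T.entry x.1 (x.2 - 1) ≤ T.entry x.1 x.2 := T.1.row_weak (by omega) hx1.2
    have hle' : T.entry x.1 j ≤ T.entry x.1 (x.2 - 1) := T.1.row_weak_of_le (by omega) hm'
    by_contra hcon
    refine firstUnmatchedPos_left hpw hasymm h (b := (x.1, x.2 - 1))
      ((hmem _).2 hm') (Or.inl (by simp only; omega)) ?_ ?_
    · refine neg_sign_eq_one_iff.2 ?_
      simp only
      omega
    · rintro ⟨r, c⟩ hm1 hm2 hm3 hs
      have hrc := (hmem _).1 hm1
      have hv := neg_sign_eq_neg_one_iff.1 hs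
      simp only [readsBefore] at hm2 hm3 hv
      by_cases hc : c = x.2
      · subst hc
        have : T.entry x.1 x.2 < T.entry r x.2 := T.1.col_strict (by omega) hrc
        omega
      · have hc' : c = x.2 - 1 := by omega
        subst hc'
        have hr : r < x.1 := by omega
        have hmr : (r, x.2) ∈ μ := μ.up_left_mem hr.le le_rfl hx1.2
        have h1 := habove r hr
        have h2 : T.entry r (x.2 - 1) ≤ T.entry r x.2 := T.1.row_weak (by omega) hmr
        omega
  · intro j hj hm
    have : T.entry x.1 x.2 ≤ T.entry x.1 j := T.1.row_weak hj hm
    omega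
  · intro r hr hm
    have : T.entry x.1 x.2 < T.entry r x.2 := T.1.col_strict hr hm
    omega

/-- `f̃` on tableaux: the letter at the leftmost remaining `+` is replaced by the next one. -/
def raise (T : BarTableau n μ) (i : Fin n) (x : ℕ × ℕ)
    (h : firstUnmatchedPos (T.sign i) (readingCells μ) = some x) : BarTableau n μ :=
  have hs := T.raise_spec i x h
  T.setEntry x (T.entry x.1 x.2 + 1) hs.1 hs.2.1 hs.2.2.1 hs.2.2.2.1 hs.2.2.2.2.1 hs.2.2.2.2.2

/-- `ẽ` on tableaux: the letter at the rightmost remaining `-` is replaced by the previous one. -/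
def lower (T : BarTableau n μ) (i : Fin n) (hi : (i : ℕ) + 1 < n) (x : ℕ × ℕ)
    (h : lastUnmatchedNeg (T.sign i) (readingCells μ) = some x) : BarTableau n μ :=
  have hs := T.lower_spec i hi x h
  T.setEntry x (T.entry x.1 x.2 - 1) hs.1 hs.2.1 hs.2.2.1 hs.2.2.2.1 hs.2.2.2.2.1 hs.2.2.2.2.2

/-- The weight: each letter with a bar over `k` contributes `-ε_k`. -/
def wt (T : BarTableau n μ) : Weight n :=
  -∑ x ∈ μ.cells, eps n (n - 1 - T.entry x.1 x.2)

end BarTableau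

/-- The crystal `𝐒_μ`: the `𝔩`-crystal of semistandard tableaux, in which `ẽ_i`, `f̃_i` act through
the reading word by the signature rule, with trivial `ẽ_n`, `f̃_n` and `ε_n = φ_n = -∞`. -/
def tableauCrystal (n : ℕ) (μ : YoungDiagram) : CrystalData n where
  carrier := BarTableau n μ
  wt T := T.wt
  ε i T := if (i : ℕ) + 1 < n then
      ((unmatchedNeg (T.sign i) (readingCells μ) : ℤ) : WithBot ℤ) else ⊥
  φ i T := if (i : ℕ) + 1 < n then
      ((unmatchedPos (T.sign i) (readingCells μ) : ℤ) : WithBot ℤ) else ⊥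
  e i T := if hi : (i : ℕ) + 1 < n then
      (lastUnmatchedNeg (T.sign i) (readingCells μ)).pmap (fun x hx => T.lower i hi x hx)
        (fun _ hx => hx) else none
  f i T := if (i : ℕ) + 1 < n then
      (firstUnmatchedPos (T.sign i) (readingCells μ)).pmap (fun x hx => T.raise i x hx)
        (fun _ hx => hx) else none

/-- The Lusztig datum `𝐜_J(T)`: the multiplicity of `ε_i - ε_j` is the number of the letters with a
bar over `i` in row `n - j + 1`. (With indices from zero: of the entries `n - 1 - i` in row
`n - 1 - j`.) -/
def tableauDatum {n : ℕ} {μ : YoungDiagram} (T : BarTableau n μ) : LusztigDatum n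
  | Sum.inl _ => 0
  | Sum.inr p => ((μ.row (n - 1 - p.1.2)).filter
      fun x => T.entry x.1 x.2 = n - 1 - p.1.1).card

/-- The weight `ε_μ = -∑ μ_r ε_{n-r+1}`. -/
def shapeWeight (n : ℕ) (μ : YoungDiagram) : Weight n := fun k => -(μ.rowLen (n - 1 - k) : ℤ)

/-- The map `T ↦ 𝐜_J(T) ⊗ t_{ε_μ}`. -/
noncomputable def tableauMap {n : ℕ} (hn : 2 ≤ n) (μ : YoungDiagram) (T : (tableauCrystal n μ).carrier) :
    (tensor (leviCrystal hn) (trivialCrystal (shapeWeight n μ))).carrier :=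
  (⟨tableauDatum T, fun _ => rfl⟩, ())

end CrystalD

/-! Fix an index `i` other than the last. Let `v` be the letter of sign `+` and `v + 1` the letter
of sign `-`, let N_r(w) be the number of entries w in row r (rows and letters count from zero), and
put h(r) = (N_0(v+1) + ... + N_r(v+1)) - (N_0(v) + ... + N_{r-1}(v)), which is `rowHeight`. Both
sides of the comparison are governed by the maximum of h.

Lusztig side. On data supported on the roots ε_a - ε_b, the braid moves involving roots ε_a + ε_b do
nothing. The others, one for each row r = v-1, ..., 0, replace the multiplicity x of the simple root
by N_r(v+1) + max(x - N_r(v), 0), starting from N_v(v+1). Unfolding gives x = max h(r) over r ≤ v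
(`diffFold_tableauDatum`).

Tableau side. The number of uncancelled `-` is the largest excess of `-` over `+` in a prefix of the
reading word. In the column reading, a prefix ending at a `-` in row r has excess at most h(r), with
equality at the leftmost `v + 1` of that row (`signHeight_of_neg`). Hence the two functions ε_i
agree (`lusztigEps_tableauDatum`).

Operators. On tableaux, f̃_i acts in the last row r where h is maximal (`IsRaise.rowHeight`), moving
one unit from N_r(v) to N_r(v+1). Since h is smaller on all later rows, x < N_r(v) when the move of
row r is reached, and that move turns the change into one extra unit of x (`braidMove_shift`). Since
h(r) is a global maximum, N_s(v) ≤ x at the moves of the rows s < r, and the unit passes through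
(`braidMove_update`). So the transformed data differ only by one at the simple root, which is the
definition of f̃_i (`IsRaise.tableauDatum_eq`).

Weights agree because a cell in row r with entry w contributes ε_{n-w} - ε_{n-r}, a root or zero.
Injectivity holds because the recorded counts and the row lengths determine a tableau. The
statements for φ_i and ẽ_i then follow from the crystal axioms. -/

namespace CrystalD

/-! ### Pairing with simple coroots -/

section Pairing

variable {n : ℕ}

theorem corootPairing_add (i : Fin n) (v w : Weight n) :
    corootPairing i (v + w) = corootPairing i v + corootPairing i w := by
  simp [corootPairing, mul_add, Finset.sum_add_distrib]

theorem corootPairing_sub (i : Fin n) (v w : Weight n) :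
    corootPairing i (v - w) = corootPairing i v - corootPairing i w := by
  simp [corootPairing, mul_sub, Finset.sum_sub_distrib]

theorem sum_eps_mul (w : Weight n) (a : Fin n) : ∑ k, eps n a k * w k = w a := by
  rw [Finset.sum_eq_single a]
  · simp [eps]
  · intro b _ hb
    simp [eps, Fin.val_inj, hb]
  · simp

theorem corootPairing_of_lt (i : Fin n) (h : (i : ℕ) + 1 < n) (w : Weight n) :
    corootPairing i w = w i - w ⟨i + 1, h⟩ := by
  simp only [corootPairing, simpleRootVec, if_pos h, Pi.sub_apply, sub_mul,
    Finset.sum_sub_distrib]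
  rw [sum_eps_mul, sum_eps_mul w ⟨i + 1, h⟩]

theorem corootPairing_simpleRootVec (hn : 2 ≤ n) (i : Fin n) :
    corootPairing i (simpleRootVec i) = 2 := by
  by_cases h : (i : ℕ) + 1 < n
  · rw [corootPairing_of_lt i h]
    simp [simpleRootVec, h, eps]
  · have h1 := sum_eps_mul (simpleRootVec i) ⟨n - 2, by omega⟩
    have h2 := sum_eps_mul (simpleRootVec i) ⟨n - 1, by omega⟩
    have h3 : corootPairing i (simpleRootVec i) =
        ∑ k, (eps n (n - 2) + eps n (n - 1)) k * simpleRootVec i k := by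
      simp only [corootPairing, simpleRootVec, if_neg h]
    rw [h3]
    simp only [Pi.add_apply, add_mul, Finset.sum_add_distrib]
    simp only at h1 h2
    rw [h1, h2]
    have h4 : n - 2 ≠ n - 1 := by omega
    simp [simpleRootVec, h, eps, h4, h4.symm]

end Pairing

/-! ### Crystal axioms and the tensor product with a one-element crystal -/

section Axioms

variable {n : ℕ}

/-- The axioms on `ẽ_i`, and that on `φ_i` and `f̃_i`, follow from the other ones. -/
theorem CrystalData.IsCrystal.of_f (hn : 2 ≤ n) {X : CrystalData n}
    (phi_eq : ∀ i b, X.φ i b = X.ε i b + ((corootPairing i (X.wt b) : ℤ) : WithBot ℤ))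
    (wt_f : ∀ i b b', X.f i b = some b' → X.wt b' = X.wt b - simpleRootVec i)
    (eps_f : ∀ i b b', X.f i b = some b' → X.ε i b' = X.ε i b + 1)
    (f_iff_e : ∀ i b b', X.f i b = some b' ↔ X.e i b' = some b)
    (of_phi_bot : ∀ i b, X.φ i b = ⊥ → X.e i b = none ∧ X.f i b = none) : X.IsCrystal := by
  have phi_f : ∀ i b b', X.f i b = some b' → X.φ i b = X.φ i b' + 1 := by
    intro i b b' h
    -- The net change of φ is 1 - ⟨h_i, α_i⟩ = -1.
    rw [phi_eq, phi_eq, wt_f i b b' h, eps_f i b b' h, corootPairing_sub,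
      corootPairing_simpleRootVec hn]
    cases X.ε i b with
    | bot => simp
    | coe x =>
      norm_cast
      ring
  refine ⟨phi_eq, ?_, ?_, ?_, wt_f, eps_f, phi_f, f_iff_e, of_phi_bot⟩
  · intro i b b' h
    rw [wt_f i b' b ((f_iff_e i b' b).2 h), sub_add_cancel]
  · exact fun i b b' h => eps_f i b' b ((f_iff_e i b' b).2 h)
  · exact fun i b b' h => phi_f i b' b ((f_iff_e i b' b).2 h)

theorem map_pair_eq_some_iff {α : Type*} (o : Option α) (b b' : α × Unit) :
    o.map (fun x => (x, b.2)) = some b' ↔ o = some b'.1 := by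
  cases o <;> simp [Prod.ext_iff]

/-- The side condition in the tensor product rule fails only when φ is `⊥`, and then f̃ already
vanishes on the left factor. So tensoring with T_w only shifts weights and φ. -/
theorem tensor_trivial_f_iff {X : CrystalData n} (hX : X.IsCrystal) (w : Weight n) (i : Fin n)
    (b b' : (tensor X (trivialCrystal w)).carrier) :
    (tensor X (trivialCrystal w)).f i b = some b' ↔ X.f i b.1 = some b'.1 := by
  change (if ⊥ < X.φ i b.1 then (X.f i b.1).map (fun x => (x, b.2)) else none) = some b' ↔ _
  split_ifs with h
  · exact map_pair_eq_some_iff _ b b'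
  · rw [(hX.of_phi_bot i b.1 (not_bot_lt_iff.1 h)).2]
    simp

theorem tensor_trivial_e_iff (X : CrystalData n) (w : Weight n) (i : Fin n)
    (b b' : (tensor X (trivialCrystal w)).carrier) :
    (tensor X (trivialCrystal w)).e i b = some b' ↔ X.e i b.1 = some b'.1 := by
  change (if ⊥ ≤ X.φ i b.1 then (X.e i b.1).map (fun x => (x, b.2)) else none) = some b' ↔ _
  rw [if_pos bot_le]
  exact map_pair_eq_some_iff _ b b'

theorem tensor_trivial_eps (X : CrystalData n) (w : Weight n) (i : Fin n)
    (b : (tensor X (trivialCrystal w)).carrier) :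
    (tensor X (trivialCrystal w)).ε i b = X.ε i b.1 := by
  change max _ (⊥ + _) = _
  simp

theorem tensor_trivial_phi (X : CrystalData n) (w : Weight n) (i : Fin n)
    (b : (tensor X (trivialCrystal w)).carrier) :
    (tensor X (trivialCrystal w)).φ i b =
      X.φ i b.1 + ((corootPairing i w : ℤ) : WithBot ℤ) := by
  change max _ ⊥ = _
  simp [trivialCrystal]

theorem tensor_trivial_isCrystal (hn : 2 ≤ n) {X : CrystalData n} (hX : X.IsCrystal)
    (w : Weight n) : (tensor X (trivialCrystal w)).IsCrystal := by
  have hwt : ∀ b, (tensor X (trivialCrystal w)).wt b = X.wt b.1 + w := fun _ => rfl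
  apply CrystalData.IsCrystal.of_f hn
  · intro i b
    rw [tensor_trivial_eps, tensor_trivial_phi, hX.phi_eq, hwt, corootPairing_add,
      WithBot.coe_add, add_assoc]
  · intro i b b' h
    rw [hwt, hwt, hX.wt_f i _ _ ((tensor_trivial_f_iff hX w i b b').1 h)]
    abel
  · intro i b b' h
    rw [tensor_trivial_eps, tensor_trivial_eps,
      hX.eps_f i _ _ ((tensor_trivial_f_iff hX w i b b').1 h)]
  · intro i b b'
    rw [tensor_trivial_f_iff hX, tensor_trivial_e_iff, hX.f_iff_e]
  · intro i b h
    rw [tensor_trivial_phi, hX.phi_eq] at h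
    have h' : X.φ i b.1 = ⊥ := by
      rw [hX.phi_eq]
      cases hb : X.ε i b.1 with
      | bot => simp
      | coe x =>
        rw [hb] at h
        norm_cast at h
    have hbot := hX.of_phi_bot i _ h'
    refine ⟨Option.eq_none_iff_forall_ne_some.2 fun b' hb => ?_,
      Option.eq_none_iff_forall_ne_some.2 fun b' hb => ?_⟩
    · rw [tensor_trivial_e_iff, hbot.1] at hb
      cases hb
    · rw [tensor_trivial_f_iff hX, hbot.2] at hb
      cases hb

end Axioms

/-! ### Braid moves and the crystal axioms for Lusztig data -/

section Braid

variable {n : ℕ}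

/-- The roots `α, γ, β` of a braid move: they are distinct, and `γ = α + β`. -/
structure IsBraidTriple (t : PosRoot n × PosRoot n × PosRoot n) : Prop where
  ne₁₂ : t.1 ≠ t.2.1
  ne₁₃ : t.1 ≠ t.2.2
  ne₂₃ : t.2.1 ≠ t.2.2
  vec_eq : PosRoot.vec t.2.1 = PosRoot.vec t.1 + PosRoot.vec t.2.2

theorem IsBraidTriple.of_mem_toFront {i : Fin n} {t : PosRoot n × PosRoot n × PosRoot n}
    (ht : t ∈ toFront i) : IsBraidTriple t := by
  unfold toFront at ht
  split_ifs at ht with h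
  · simp only [List.mem_append, diffTriples, lowTriples, highTriples, List.mem_filterMap] at ht
    rcases ht with (⟨k, -, hk⟩ | ⟨k, -, hk⟩) | ⟨k, -, hk⟩ <;>
    · split_ifs at hk with hlt
      obtain rfl := (Option.some.inj hk)
      simp only [Fin.lt_def] at hlt
      refine ⟨?_, ?_, ?_, ?_⟩
      · simp [Fin.ext_iff]
      · simp [Fin.ext_iff]
        try omega
      · simp [Fin.ext_iff]
        try omega
      · simp only [PosRoot.vec]
        abel
  · simp at ht

variable {t : PosRoot n × PosRoot n × PosRoot n}

theorem braidMove_fst (c : LusztigDatum n) :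
    braidMove t c t.1 = c t.1 + c t.2.1 - min (c t.1) (c t.2.2) := if_pos rfl

theorem braidMove_snd (ht : IsBraidTriple t) (c : LusztigDatum n) :
    braidMove t c t.2.1 = min (c t.1) (c t.2.2) := by
  simp [braidMove, ht.ne₁₂.symm]

theorem braidMove_thd (ht : IsBraidTriple t) (c : LusztigDatum n) :
    braidMove t c t.2.2 = c t.2.2 + c t.2.1 - min (c t.1) (c t.2.2) := by
  simp [braidMove, ht.ne₁₃.symm, ht.ne₂₃.symm]

theorem braidMove_of_ne (c : LusztigDatum n) {r : PosRoot n} (h1 : r ≠ t.1) (h2 : r ≠ t.2.1)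
    (h3 : r ≠ t.2.2) : braidMove t c r = c r := by
  simp [braidMove, h1, h2, h3]

/-- With m = min a b, one of a - m and b - m is zero, so the minimum of the two new outer
multiplicities is the old middle one. The truncated subtractions lose nothing because m ≤ a, b. -/
theorem braidMove_braidMove (ht : IsBraidTriple t) (c : LusztigDatum n) :
    braidMove t (braidMove t c) = c := by
  funext r
  by_cases h1 : r = t.1
  · subst h1
    rw [braidMove_fst, braidMove_fst, braidMove_snd ht, braidMove_thd ht]
    omega
  by_cases h2 : r = t.2.1
  · subst h2
    rw [braidMove_snd ht, braidMove_fst, braidMove_thd ht]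
    omega
  by_cases h3 : r = t.2.2
  · subst h3
    rw [braidMove_thd ht, braidMove_fst, braidMove_snd ht, braidMove_thd ht]
    omega
  rw [braidMove_of_ne _ h1 h2 h3, braidMove_of_ne _ h1 h2 h3]

/-- The outer multiplicities both change by c - m and the middle one by m - c, which cancels because
γ = α + β. -/
theorem wt_braidMove (ht : IsBraidTriple t) (c : LusztigDatum n) :
    LusztigDatum.wt (braidMove t c) = LusztigDatum.wt c := by
  unfold LusztigDatum.wt
  rw [neg_inj, ← sub_eq_zero, ← Finset.sum_sub_distrib]
  have h2 : t.2.1 ∈ (Finset.univ : Finset (PosRoot n)).erase t.1 := by simp [ht.ne₁₂.symm]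
  have h3 : t.2.2 ∈ ((Finset.univ : Finset (PosRoot n)).erase t.1).erase t.2.1 := by
    simp [ht.ne₁₃.symm, ht.ne₂₃.symm]
  rw [← Finset.add_sum_erase _ _ (Finset.mem_univ t.1), ← Finset.add_sum_erase _ _ h2,
    ← Finset.add_sum_erase _ _ h3, Finset.sum_eq_zero, braidMove_fst, braidMove_snd ht,
    braidMove_thd ht, ht.vec_eq, ← sub_smul, ← sub_smul, ← sub_smul]
  · have e1 : ((c t.1 + c t.2.1 - min (c t.1) (c t.2.2) : ℕ) : ℤ) - c t.1 =
        c t.2.1 - (min (c t.1) (c t.2.2) : ℕ) := by omega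
    have e3 : ((c t.2.2 + c t.2.1 - min (c t.1) (c t.2.2) : ℕ) : ℤ) - c t.2.2 =
        c t.2.1 - (min (c t.1) (c t.2.2) : ℕ) := by omega
    rw [e1, e3]
    module
  · intro r hr
    simp only [Finset.mem_erase] at hr
    rw [braidMove_of_ne _ hr.2.2.1 hr.2.1 hr.1, sub_self]

theorem foldl_reverse_braidMove (l : List (PosRoot n × PosRoot n × PosRoot n)) :
    (∀ t ∈ l, IsBraidTriple t) → ∀ c : LusztigDatum n,
      l.reverse.foldl (fun d t => braidMove t d) (l.foldl (fun d t => braidMove t d) c) = c := by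
  induction l with
  | nil => exact fun _ _ => rfl
  | cons t l ih =>
    intro hl c
    rw [List.reverse_cons, List.foldl_append, List.foldl_cons (l := l),
      ih (fun s hs => hl s (List.mem_cons_of_mem _ hs))]
    exact braidMove_braidMove (hl t List.mem_cons_self) c

theorem wt_foldl_braidMove (l : List (PosRoot n × PosRoot n × PosRoot n)) :
    (∀ t ∈ l, IsBraidTriple t) → ∀ c : LusztigDatum n,
      LusztigDatum.wt (l.foldl (fun d t => braidMove t d) c) = LusztigDatum.wt c := by
  induction l with
  | nil => exact fun _ _ => rfl
  | cons t l ih =>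
    intro hl c
    rw [List.foldl_cons, ih (fun s hs => hl s (List.mem_cons_of_mem _ hs)),
      wt_braidMove (hl t List.mem_cons_self)]

theorem transitionInv_transition (i : Fin n) (c : LusztigDatum n) :
    transitionInv i (transition i c) = c :=
  foldl_reverse_braidMove _ (fun _ ht => .of_mem_toFront ht) c

theorem transition_transitionInv (i : Fin n) (c : LusztigDatum n) :
    transition i (transitionInv i c) = c := by
  have h := foldl_reverse_braidMove (toFront i).reverse
    (fun _ ht => .of_mem_toFront (List.mem_reverse.1 ht)) c
  rwa [List.reverse_reverse] at h

theorem wt_transition (i : Fin n) (c : LusztigDatum n) :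
    LusztigDatum.wt (transition i c) = LusztigDatum.wt c :=
  wt_foldl_braidMove _ (fun _ ht => .of_mem_toFront ht) c

theorem vec_simpleRoot (hn : 2 ≤ n) (i : Fin n) :
    PosRoot.vec (simpleRoot hn i) = simpleRootVec i := by
  unfold simpleRoot simpleRootVec
  split_ifs <;> rfl

theorem wt_update (c : LusztigDatum n) (r : PosRoot n) :
    LusztigDatum.wt (Function.update c r (c r + 1)) = LusztigDatum.wt c - PosRoot.vec r := by
  unfold LusztigDatum.wt
  rw [← Finset.add_sum_erase _ _ (Finset.mem_univ r),
    ← Finset.add_sum_erase Finset.univ (fun r => (c r : ℤ) • PosRoot.vec r) (Finset.mem_univ r)]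
  rw [Finset.sum_congr rfl (g := fun r => (c r : ℤ) • PosRoot.vec r)]
  · rw [Function.update_self]
    push_cast
    module
  · intro x hx
    rw [Function.update_of_ne (Finset.ne_of_mem_erase hx)]

theorem transition_lusztigF (hn : 2 ≤ n) (i : Fin n) (c : LusztigDatum n) :
    transition i (lusztigF hn i c) =
      Function.update (transition i c) (simpleRoot hn i) (lusztigEps hn i c + 1) :=
  transition_transitionInv i _

theorem lusztigEps_lusztigF (hn : 2 ≤ n) (i : Fin n) (c : LusztigDatum n) :
    lusztigEps hn i (lusztigF hn i c) = lusztigEps hn i c + 1 := by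
  rw [lusztigEps, transition_lusztigF, Function.update_self]

theorem wt_lusztigF (hn : 2 ≤ n) (i : Fin n) (c : LusztigDatum n) :
    LusztigDatum.wt (lusztigF hn i c) = LusztigDatum.wt c - simpleRootVec i := by
  rw [← wt_transition i, transition_lusztigF, ← vec_simpleRoot hn, ← wt_transition i c]
  exact wt_update _ _

theorem lusztigE_lusztigF (hn : 2 ≤ n) (i : Fin n) (c : LusztigDatum n) :
    lusztigE hn i (lusztigF hn i c) = c := by
  rw [lusztigE, transition_lusztigF, lusztigEps_lusztigF, Nat.add_sub_cancel,
    Function.update_idem, lusztigEps, Function.update_eq_self, transitionInv_transition]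

theorem lusztigF_lusztigE (hn : 2 ≤ n) (i : Fin n) (c : LusztigDatum n)
    (h : lusztigEps hn i c ≠ 0) : lusztigF hn i (lusztigE hn i c) = c := by
  have h1 : transition i (lusztigE hn i c) =
      Function.update (transition i c) (simpleRoot hn i) (lusztigEps hn i c - 1) :=
    transition_transitionInv i _
  have h2 : lusztigEps hn i (lusztigE hn i c) = lusztigEps hn i c - 1 := by
    rw [lusztigEps, h1, Function.update_self]
  rw [lusztigF, h1, h2, Nat.sub_add_cancel (Nat.one_le_iff_ne_zero.2 h),
    Function.update_idem, lusztigEps, Function.update_eq_self, transitionInv_transition]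

theorem leviCrystal_f_iff (hn : 2 ≤ n) {i : Fin n} (hi : (i : ℕ) + 1 < n)
    (b b' : (leviCrystal hn).carrier) :
    (leviCrystal hn).f i b = some b' ↔ lusztigF hn i b.1 = b'.1 := by
  have hf : (leviCrystal hn).f i b = some ⟨lusztigF hn i b.1, isLevi_update hn hi b.2 _⟩ :=
    dif_pos hi
  rw [hf]
  exact ⟨fun h => congrArg Subtype.val (Option.some.inj h),
    fun h => congrArg some (Subtype.ext h)⟩

theorem leviCrystal_e_iff (hn : 2 ≤ n) {i : Fin n} (hi : (i : ℕ) + 1 < n)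
    (b b' : (leviCrystal hn).carrier) :
    (leviCrystal hn).e i b = some b' ↔ lusztigEps hn i b.1 ≠ 0 ∧ lusztigE hn i b.1 = b'.1 := by
  have he : (leviCrystal hn).e i b = if lusztigEps hn i b.1 = 0 then none
      else some ⟨lusztigE hn i b.1, isLevi_update hn hi b.2 _⟩ := dif_pos hi
  rw [he]
  split_ifs with h0
  · exact ⟨fun h => h.elim, fun h => absurd h0 h.1⟩
  · exact ⟨fun h => ⟨h0, congrArg Subtype.val (Option.some.inj h)⟩,
      fun h => congrArg some (Subtype.ext h.2)⟩

theorem leviCrystal_isCrystal (hn : 2 ≤ n) : (leviCrystal hn).IsCrystal := by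
  apply CrystalData.IsCrystal.of_f hn
  · intro i b
    simp only [leviCrystal, lusztigCrystal]
    split_ifs
    · exact WithBot.coe_add _ _
    · simp
  · intro i b b' h
    simp only [leviCrystal] at h
    split_ifs at h
    obtain rfl := Option.some.inj h
    exact wt_lusztigF hn i b.1
  · intro i b b' h
    simp only [leviCrystal] at h
    split_ifs at h with hi
    obtain rfl := Option.some.inj h
    simp only [leviCrystal, lusztigCrystal, if_pos hi, lusztigEps_lusztigF]
    rfl
  · intro i b b'
    by_cases hi : (i : ℕ) + 1 < n
    · rw [leviCrystal_f_iff hn hi, leviCrystal_e_iff hn hi]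
      constructor
      · intro h
        rw [← h, lusztigEps_lusztigF, lusztigE_lusztigF]
        exact ⟨Nat.succ_ne_zero _, rfl⟩
      · rintro ⟨h0, h⟩
        rw [← h, lusztigF_lusztigE hn i _ h0]
    · simp [leviCrystal, hi]
  · intro i b h
    simp only [leviCrystal, lusztigCrystal] at h ⊢
    split_ifs at h with hi
    · exact absurd h (WithBot.coe_ne_bot)
    · simp [hi]

end Braid

/-! ### Cancellation of signs and heights of prefixes -/

section SignatureRule

variable {α : Type*}

/-- The number of the signs `+` that remain after cancellation, read from the left. -/
def remainingPos (s : α → SignType) : List α → ℕ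
  | [] => 0
  | a :: l => if s a = 1 then remainingPos s l + (1 - unmatchedNeg s l) else remainingPos s l

/-- The `+` left over in the first word cancel against the `-` left over in the second; the
truncated subtraction covers a surplus of `+`. -/
theorem unmatchedNeg_append (s : α → SignType) (l l' : List α) :
    unmatchedNeg s (l ++ l') = unmatchedNeg s l + (unmatchedNeg s l' - remainingPos s l) := by
  induction l with
  | nil => simp [unmatchedNeg, remainingPos]
  | cons a l ih =>
    simp only [List.cons_append, unmatchedNeg, remainingPos, ih]
    split_ifs <;> omega

theorem remainingPos_append (s : α → SignType) (l l' : List α) :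
    remainingPos s (l ++ l') = remainingPos s l' + (remainingPos s l - unmatchedNeg s l') := by
  induction l with
  | nil => simp [remainingPos]
  | cons a l ih =>
    simp only [List.cons_append, remainingPos, ih, unmatchedNeg_append]
    split_ifs <;> omega

theorem signType_trichotomy (σ : SignType) : σ = 0 ∨ σ = 1 ∨ σ = -1 := by
  cases σ <;> decide

/-- A pair `(+, -)` is again a pair `(+, -)` after reversing the word and changing all signs, so the
two kinds of leftover signs are exchanged. -/
theorem reverse_neg (s : α → SignType) (l : List α) :
    unmatchedNeg (fun a => -s a) l.reverse = remainingPos s l ∧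
      remainingPos (fun a => -s a) l.reverse = unmatchedNeg s l := by
  induction l with
  | nil => exact ⟨rfl, rfl⟩
  | cons a l ih =>
    rw [List.reverse_cons, unmatchedNeg_append, remainingPos_append, ih.1, ih.2]
    rcases signType_trichotomy (s a) with h | h | h <;>
      simp [unmatchedNeg, remainingPos, h, add_comm]

theorem unmatchedPos_eq (s : α → SignType) (l : List α) :
    unmatchedPos s l = remainingPos s l := (reverse_neg s l).1

/-- Each `+` of `l` is followed by a stretch with a leftover `-`. As `m` leaves none over, that `-`
lies in `l` and is available to cancel the `+`. -/
theorem remainingPos_eq_zero (s : α → SignType) (l m : List α) :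
    (∀ A₁ A₂ b, l = A₁ ++ b :: A₂ → s b = 1 → unmatchedNeg s (A₂ ++ m) ≠ 0) →
      unmatchedNeg s m = 0 → remainingPos s l = 0 := by
  intro h hm
  induction l with
  | nil => rfl
  | cons a l ih =>
    have hl := ih (fun A₁ A₂ b hA => h (a :: A₁) A₂ b (by rw [hA]; rfl))
    unfold remainingPos
    split_ifs with ha
    · have h1 := h [] l a rfl ha
      rw [unmatchedNeg_append] at h1
      omega
    · exact hl

/-- The leftmost remaining `+` is preceded by remaining signs `-` only, and no `-` remains to the
right of it. -/
theorem firstUnmatchedPos_eq_some_iff {s : α → SignType} {l : List α} {a : α} :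
    firstUnmatchedPos s l = some a ↔ ∃ A B, l = A ++ a :: B ∧ s a = 1 ∧ remainingPos s A = 0 ∧
      unmatchedNeg s B = 0 := by
  constructor
  · intro h
    obtain ⟨A, B, hl, h1, h2, h3⟩ := firstUnmatchedPos_spec h
    refine ⟨A, B, hl, h1, remainingPos_eq_zero s A (a :: B) h3 ?_, h2⟩
    simp [unmatchedNeg, h1, h2]
  · rintro ⟨A, B, rfl, h1, h2, h3⟩
    induction A with
    | nil => simp [firstUnmatchedPos, h1, h3]
    | cons x A ih =>
      unfold remainingPos at h2
      rw [List.cons_append]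
      unfold firstUnmatchedPos
      have hA : remainingPos s A = 0 := by
        split_ifs at h2 <;> omega
      rw [if_neg, ih hA]
      rintro ⟨hx, hu⟩
      rw [if_pos hx] at h2
      rw [unmatchedNeg_append] at hu
      omega

/-- The conditions on the two sides of the position are those for the leftmost remaining `+`; only
the sign at the position differs. This is why ẽ and f̃ are mutually inverse on tableaux. -/
theorem lastUnmatchedNeg_eq_some_iff {s : α → SignType} {l : List α} {a : α} :
    lastUnmatchedNeg s l = some a ↔ ∃ A B, l = A ++ a :: B ∧ s a = -1 ∧ remainingPos s A = 0 ∧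
      unmatchedNeg s B = 0 := by
  unfold lastUnmatchedNeg
  rw [firstUnmatchedPos_eq_some_iff]
  have hneg : ∀ σ : SignType, -σ = 1 ↔ σ = -1 := by decide
  constructor
  · rintro ⟨A, B, hl, h1, h2, h3⟩
    refine ⟨B.reverse, A.reverse, ?_, (hneg _).1 h1, ?_, ?_⟩
    · rw [← List.reverse_reverse l, hl]
      simp
    · rw [← (reverse_neg s B.reverse).1, List.reverse_reverse, h3]
    · rw [← (reverse_neg s A.reverse).2, List.reverse_reverse, h2]
  · rintro ⟨A, B, rfl, h1, h2, h3⟩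
    refine ⟨B.reverse, A.reverse, by simp, (hneg _).2 h1, ?_, ?_⟩
    · rw [(reverse_neg s B).2, h3]
    · rw [(reverse_neg s A).1, h2]

theorem unmatchedNeg_congr {s s' : α → SignType} {l : List α} (h : ∀ a ∈ l, s a = s' a) :
    unmatchedNeg s l = unmatchedNeg s' l := by
  induction l with
  | nil => rfl
  | cons a l ih =>
    simp only [unmatchedNeg, h a List.mem_cons_self,
      ih (fun b hb => h b (List.mem_cons_of_mem _ hb))]

theorem remainingPos_congr {s s' : α → SignType} {l : List α} (h : ∀ a ∈ l, s a = s' a) :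
    remainingPos s l = remainingPos s' l := by
  induction l with
  | nil => rfl
  | cons a l ih =>
    have h' := fun b hb => h b (List.mem_cons_of_mem _ hb)
    simp only [remainingPos, h a List.mem_cons_self, ih h', unmatchedNeg_congr h']

/-- The number of signs `-` minus the number of signs `+`. -/
def signHeight (s : α → SignType) (l : List α) : ℤ := (l.map fun a => -(s a : ℤ)).sum

theorem signHeight_append (s : α → SignType) (l l' : List α) :
    signHeight s (l ++ l') = signHeight s l + signHeight s l' := by
  simp [signHeight]

theorem signHeight_cons (s : α → SignType) (a : α) (l : List α) :
    signHeight s (a :: l) = -(s a : ℤ) + signHeight s l := by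
  simp [signHeight]

theorem signHeight_eq (s : α → SignType) (l : List α) :
    signHeight s l = unmatchedNeg s l - remainingPos s l := by
  induction l with
  | nil => rfl
  | cons a l ih =>
    rw [signHeight_cons, ih]
    rcases signType_trichotomy (s a) with h | h | h <;>
      simp [unmatchedNeg, remainingPos, h] <;> omega

/-- One half of the description of `unmatchedNeg` as the largest height of a prefix; attainment is
`exists_signHeight_eq`. -/
theorem signHeight_le (s : α → SignType) (l l' : List α) :
    signHeight s l ≤ unmatchedNeg s (l ++ l') := by
  rw [signHeight_eq, unmatchedNeg_append]
  omega

/-- The height is maximal after some initial segment, empty or with last sign `-`. -/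
theorem exists_signHeight_eq (s : α → SignType) (l : List α) :
    unmatchedNeg s l = 0 ∨ ∃ A a B, l = A ++ a :: B ∧ s a = -1 ∧
      (unmatchedNeg s l : ℤ) = signHeight s (A ++ [a]) := by
  by_cases h0 : unmatchedNeg s l = 0
  · exact Or.inl h0
  refine Or.inr ?_
  induction l with
  | nil => exact absurd rfl h0
  | cons x l ih =>
    have hx := signType_trichotomy (s x)
    by_cases hl : unmatchedNeg s l = 0
    · have hx1 : s x = -1 := by
        rcases hx with h | h | h
        · simp [unmatchedNeg, h, hl] at h0
        · simp [unmatchedNeg, h, hl] at h0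
        · exact h
      exact ⟨[], x, l, rfl, hx1, by simp [unmatchedNeg, hx1, hl, signHeight]⟩
    · obtain ⟨A, a, B, hAB, ha, hu⟩ := ih hl
      refine ⟨x :: A, a, B, by rw [hAB]; rfl, ha, ?_⟩
      rw [List.cons_append, signHeight_cons, ← hu]
      rcases hx with h | h | h <;> simp [unmatchedNeg, h] <;> omega

end SignatureRule

theorem readingCells_nodup (μ : YoungDiagram) : (readingCells μ).Nodup :=
  (readingCells_pairwise μ).imp (by rintro a _ h rfl; exact BarTableau.readsBefore_asymm a a h h)

/-! ### Raising and lowering a tableau as inverse relations -/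

namespace BarTableau

variable {n : ℕ} {μ : YoungDiagram}

theorem ext_entry {T T' : BarTableau n μ} (h : ∀ r c, T.entry r c = T'.entry r c) : T = T' :=
  Subtype.ext (SemistandardYoungTableau.ext h)

theorem raise_entry (T : BarTableau n μ) (i : Fin n) (x : ℕ × ℕ)
    (h : firstUnmatchedPos (T.sign i) (readingCells μ) = some x) (r c : ℕ) :
    (T.raise i x h).entry r c = if (r, c) = x then T.entry x.1 x.2 + 1 else T.entry r c := rfl

theorem lower_entry (T : BarTableau n μ) (i : Fin n) (hi : (i : ℕ) + 1 < n) (x : ℕ × ℕ)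
    (h : lastUnmatchedNeg (T.sign i) (readingCells μ) = some x) (r c : ℕ) :
    (T.lower i hi x h).entry r c =
      if (r, c) = x then T.entry x.1 x.2 - 1 else T.entry r c := rfl

theorem sign_congr {T T' : BarTableau n μ} {i : Fin n} {y : ℕ × ℕ}
    (h : T.entry y.1 y.2 = T'.entry y.1 y.2) : T.sign i y = T'.sign i y := by
  unfold sign
  rw [h]

/-- `T'` arises from `T` by applying `f̃` at the cell `x`. -/
structure IsRaise (i : Fin n) (T T' : BarTableau n μ) (x : ℕ × ℕ) : Prop where
  first : firstUnmatchedPos (T.sign i) (readingCells μ) = some x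
  entry_eq : ∀ r c, T'.entry r c = if (r, c) = x then T.entry x.1 x.2 + 1 else T.entry r c

theorem IsRaise.sign_self {i : Fin n} {T T' : BarTableau n μ} {x : ℕ × ℕ}
    (h : IsRaise i T T' x) : T.sign i x = 1 := by
  obtain ⟨-, -, -, h1, -⟩ := firstUnmatchedPos_eq_some_iff.1 h.first
  exact h1

theorem IsRaise.sign_self' {i : Fin n} {T T' : BarTableau n μ} {x : ℕ × ℕ}
    (h : IsRaise i T T' x) : T'.sign i x = -1 := by
  have h1 := sign_eq_one_iff.1 h.sign_self
  rw [sign_eq_neg_one_iff, h.entry_eq, if_pos rfl]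
  omega

theorem IsRaise.sign_of_ne {i : Fin n} {T T' : BarTableau n μ} {x y : ℕ × ℕ}
    (h : IsRaise i T T' x) (hy : y ≠ x) : T'.sign i y = T.sign i y :=
  sign_congr ((h.entry_eq _ _).trans (if_neg hy))

theorem ne_of_readingCells_eq {A B : List (ℕ × ℕ)} {x : ℕ × ℕ}
    (h : readingCells μ = A ++ x :: B) : (∀ y ∈ A, y ≠ x) ∧ ∀ y ∈ B, y ≠ x := by
  have hnd := readingCells_nodup μ
  rw [h, List.nodup_append, List.nodup_cons] at hnd
  exact ⟨fun y hy => hnd.2.2 y hy x List.mem_cons_self,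
    fun y hy hyx => hnd.2.1.1 (hyx ▸ hy)⟩

/-- The signs before and after `x` are untouched, so the factorization of the reading word at `x`
now exhibits it as the rightmost remaining `-`. -/
theorem IsRaise.last {i : Fin n} {T T' : BarTableau n μ} {x : ℕ × ℕ} (h : IsRaise i T T' x) :
    lastUnmatchedNeg (T'.sign i) (readingCells μ) = some x := by
  obtain ⟨A, B, hl, h1, h2, h3⟩ := firstUnmatchedPos_eq_some_iff.1 h.first
  have hne := ne_of_readingCells_eq hl
  refine lastUnmatchedNeg_eq_some_iff.2 ⟨A, B, hl, h.sign_self', ?_, ?_⟩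
  · rw [remainingPos_congr fun y hy => h.sign_of_ne (hne.1 y hy), h2]
  · rw [unmatchedNeg_congr fun y hy => h.sign_of_ne (hne.2 y hy), h3]

theorem IsRaise.unmatchedNeg_eq {i : Fin n} {T T' : BarTableau n μ} {x : ℕ × ℕ}
    (h : IsRaise i T T' x) : unmatchedNeg (T'.sign i) (readingCells μ) =
      unmatchedNeg (T.sign i) (readingCells μ) + 1 := by
  obtain ⟨A, B, hl, h1, h2, h3⟩ := firstUnmatchedPos_eq_some_iff.1 h.first
  have hne := ne_of_readingCells_eq hl
  rw [hl, unmatchedNeg_append, unmatchedNeg_append,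
    remainingPos_congr fun y hy => h.sign_of_ne (hne.1 y hy),
    unmatchedNeg_congr fun y hy => h.sign_of_ne (hne.1 y hy)]
  simp only [unmatchedNeg, h.sign_self', h1,
    unmatchedNeg_congr fun y hy => h.sign_of_ne (hne.2 y hy), h3, h2]
  simp

theorem isRaise_raise (T : BarTableau n μ) (i : Fin n) (x : ℕ × ℕ)
    (h : firstUnmatchedPos (T.sign i) (readingCells μ) = some x) :
    IsRaise i T (T.raise i x h) x := ⟨h, T.raise_entry i x h⟩

theorem isRaise_lower (T : BarTableau n μ) (i : Fin n) (hi : (i : ℕ) + 1 < n) (x : ℕ × ℕ)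
    (h : lastUnmatchedNeg (T.sign i) (readingCells μ) = some x) :
    IsRaise i (T.lower i hi x h) T x := by
  obtain ⟨A, B, hl, h1, h2, h3⟩ := lastUnmatchedNeg_eq_some_iff.1 h
  have hne := ne_of_readingCells_eq hl
  have hv := sign_eq_neg_one_iff.1 h1
  have hx : (T.lower i hi x h).entry x.1 x.2 = T.entry x.1 x.2 - 1 := if_pos rfl
  -- The entry is n - 1 - i, positive because i + 1 < n, so the truncated subtraction can be undone.
  have hpos : T.entry x.1 x.2 - 1 + 1 = T.entry x.1 x.2 := by omega
  have hs : ∀ y, y ≠ x → (T.lower i hi x h).sign i y = T.sign i y := fun y hy =>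
    sign_congr ((T.lower_entry i hi x h _ _).trans (if_neg hy))
  refine ⟨firstUnmatchedPos_eq_some_iff.2 ⟨A, B, hl, ?_, ?_, ?_⟩, ?_⟩
  · rw [sign_eq_one_iff, hx]
    omega
  · rw [remainingPos_congr fun y hy => hs y (hne.1 y hy), h2]
  · rw [unmatchedNeg_congr fun y hy => hs y (hne.2 y hy), h3]
  · intro r c
    rw [hx, hpos, lower_entry]
    split_ifs with hrc
    · rw [← hrc]
    · rfl

theorem IsRaise.unique {i : Fin n} {T T' T'' : BarTableau n μ} {x y : ℕ × ℕ}
    (h : IsRaise i T T' x) (h' : IsRaise i T T'' y) : T' = T'' := by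
  obtain rfl : x = y := Option.some.inj (h.first.symm.trans h'.first)
  exact ext_entry fun r c => (h.entry_eq r c).trans (h'.entry_eq r c).symm

theorem IsRaise.unique' {i : Fin n} {T T' T'' : BarTableau n μ} {x y : ℕ × ℕ}
    (h : IsRaise i T' T x) (h' : IsRaise i T'' T y) : T' = T'' := by
  obtain rfl : x = y := Option.some.inj (h.last.symm.trans h'.last)
  refine ext_entry fun r c => ?_
  have h1 := (h.entry_eq r c).symm.trans (h'.entry_eq r c)
  split_ifs at h1 with hrc
  · subst hrc
    simpa using h1
  · exact h1

end BarTableau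

/-! ### Crystal axioms for tableaux -/

section TableauCrystal

variable {n : ℕ} {μ : YoungDiagram}

open BarTableau

theorem tableauCrystal_f_iff {i : Fin n} (hi : (i : ℕ) + 1 < n) (T T' : (tableauCrystal n μ).carrier) :
    (tableauCrystal n μ).f i T = some T' ↔ ∃ x, IsRaise (n := n) (μ := μ) i T T' x := by
  have hf : (tableauCrystal n μ).f i T =
      (firstUnmatchedPos (T.sign i) (readingCells μ)).pmap (fun x hx => T.raise i x hx)
        (fun _ hx => hx) := if_pos hi
  rw [hf]
  constructor
  · intro h
    obtain ⟨x, hx, -, hT⟩ := Option.pmap_eq_some_iff.1 h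
    exact ⟨x, hT ▸ isRaise_raise T i x hx⟩
  · rintro ⟨x, hx⟩
    exact Option.pmap_eq_some_iff.2 ⟨x, hx.first, hx.first, ((isRaise_raise T i x hx.first).unique hx).symm⟩

theorem tableauCrystal_e_iff {i : Fin n} (hi : (i : ℕ) + 1 < n) (T T' : (tableauCrystal n μ).carrier) :
    (tableauCrystal n μ).e i T = some T' ↔ ∃ x, IsRaise (n := n) (μ := μ) i T' T x := by
  have he : (tableauCrystal n μ).e i T =
      (lastUnmatchedNeg (T.sign i) (readingCells μ)).pmap (fun x hx => T.lower i hi x hx)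
        (fun _ hx => hx) := dif_pos hi
  rw [he]
  constructor
  · intro h
    obtain ⟨x, hx, -, hT⟩ := Option.pmap_eq_some_iff.1 h
    exact ⟨x, hT ▸ isRaise_lower T i hi x hx⟩
  · rintro ⟨x, hx⟩
    exact Option.pmap_eq_some_iff.2 ⟨x, hx.last, hx.last,
      ((isRaise_lower T i hi x hx.last).unique' hx).symm⟩

theorem readingCells_toFinset (μ : YoungDiagram) : (readingCells μ).toFinset = μ.cells := by
  ext x
  rw [List.mem_toFinset, mem_readingCells, YoungDiagram.mem_cells]

/-- The sign of a letter is exactly the pairing of the coroot with the weight of that letter. -/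
theorem corootPairing_tableau {i : Fin n} (hi : (i : ℕ) + 1 < n) (T : BarTableau n μ) :
    corootPairing i T.wt = -signHeight (T.sign i) (readingCells μ) := by
  rw [corootPairing_of_lt i hi, signHeight, ← List.sum_toFinset _ (readingCells_nodup μ),
    readingCells_toFinset]
  simp only [BarTableau.wt, Pi.neg_apply, Finset.sum_apply]
  rw [← sub_eq_zero, ← Finset.sum_neg_distrib, ← Finset.sum_neg_distrib,
    ← Finset.sum_neg_distrib, ← Finset.sum_sub_distrib, ← Finset.sum_sub_distrib]
  refine Finset.sum_eq_zero fun x hx => ?_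
  have hlt := T.2 x.1 x.2 hx
  simp only [BarTableau.sign, eps]
  change T.entry x.1 x.2 < n at hlt
  split_ifs <;> first | omega | simp

theorem unmatchedPos_eq_add {i : Fin n} (hi : (i : ℕ) + 1 < n) (T : BarTableau n μ) :
    (unmatchedPos (T.sign i) (readingCells μ) : ℤ) =
      unmatchedNeg (T.sign i) (readingCells μ) + corootPairing i T.wt := by
  rw [corootPairing_tableau hi, signHeight_eq, unmatchedPos_eq]
  ring

theorem BarTableau.IsRaise.wt_eq {i : Fin n} (hi : (i : ℕ) + 1 < n) {T T' : BarTableau n μ} {x : ℕ × ℕ}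
    (h : IsRaise i T T' x) : T'.wt = T.wt - simpleRootVec i := by
  have hx : x ∈ μ.cells := by
    obtain ⟨A, B, hl, -⟩ := firstUnmatchedPos_eq_some_iff.1 h.first
    exact mem_readingCells.1 (by rw [hl]; simp)
  have h1 := sign_eq_one_iff.1 h.sign_self
  have h2 := sign_eq_neg_one_iff.1 h.sign_self'
  unfold BarTableau.wt
  rw [← Finset.add_sum_erase _ _ hx,
    ← Finset.add_sum_erase _ (fun y : ℕ × ℕ => eps n (n - 1 - T.entry y.1 y.2)) hx]
  rw [Finset.sum_congr rfl (g := fun y => eps n (n - 1 - T.entry y.1 y.2))]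
  · have e1 : n - 1 - T.entry x.1 x.2 = i + 1 := by omega
    have e2 : n - 1 - T'.entry x.1 x.2 = i := by omega
    rw [e1, e2, simpleRootVec, if_pos hi]
    abel
  · intro y hy
    have := (h.entry_eq y.1 y.2).trans (if_neg (Finset.ne_of_mem_erase hy))
    rw [this]

theorem tableauCrystal_isCrystal (hn : 2 ≤ n) : (tableauCrystal n μ).IsCrystal := by
  have hf : ∀ i T T', (tableauCrystal n μ).f i T = some T' → (i : ℕ) + 1 < n := by
    intro i T T' h
    by_contra hi
    have : (tableauCrystal n μ).f i T = none := if_neg hi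
    rw [this] at h
    cases h
  apply CrystalData.IsCrystal.of_f hn
  · intro i T
    simp only [tableauCrystal]
    split_ifs with hi
    · exact (congrArg _ (unmatchedPos_eq_add hi T)).trans (WithBot.coe_add _ _)
    · simp
  · intro i T T' h
    have hi := hf i T T' h
    obtain ⟨x, hx⟩ := (tableauCrystal_f_iff hi T T').1 h
    exact hx.wt_eq hi
  · intro i T T' h
    have hi := hf i T T' h
    obtain ⟨x, hx⟩ := (tableauCrystal_f_iff hi T T').1 h
    simp only [tableauCrystal, if_pos hi, hx.unmatchedNeg_eq]
    rfl
  · intro i T T'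
    by_cases hi : (i : ℕ) + 1 < n
    · rw [tableauCrystal_f_iff hi, tableauCrystal_e_iff hi]
    · simp [tableauCrystal, hi]
  · intro i T h
    simp only [tableauCrystal] at h ⊢
    split_ifs at h with hi
    · exact absurd h WithBot.coe_ne_bot
    · simp [hi]

end TableauCrystal

/-! ### Row counts, weights and injectivity -/

namespace BarTableau

variable {n : ℕ} {μ : YoungDiagram}

/-- Columns increase strictly from at least 0. Hence the only entries of row `r` to which the datum
attaches no root are those equal to `r`. -/
theorem le_entry (T : BarTableau n μ) {r c : ℕ} (h : (r, c) ∈ μ) : r ≤ T.entry r c := by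
  induction r with
  | zero => exact Nat.zero_le _
  | succ r ih =>
    have h1 := ih (μ.up_left_mem (Nat.le_succ r) le_rfl h)
    have h2 : T.entry r c < T.entry (r + 1) c := T.1.col_strict (Nat.lt_succ_self r) h
    omega

theorem entry_lt (T : BarTableau n μ) {r c : ℕ} (h : (r, c) ∈ μ) : T.entry r c < n := T.2 r c h

/-- The number of entries `v` in row `r`. -/
def rowCount (T : BarTableau n μ) (r v : ℕ) : ℕ :=
  ((μ.row r).filter fun x => T.entry x.1 x.2 = v).card

theorem tableauDatum_diffRoot (T : BarTableau n μ) {i j : Fin n} (h : i < j) :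
    tableauDatum T (diffRoot i j h) = T.rowCount (n - 1 - j) (n - 1 - i) := rfl

theorem rowCount_eq_sum (T : BarTableau n μ) (r v : ℕ) :
    (T.rowCount r v : ℤ) = ∑ x ∈ μ.cells, if x.1 = r ∧ T.entry x.1 x.2 = v then 1 else 0 := by
  rw [rowCount, YoungDiagram.row, Finset.filter_filter, Finset.card_filter]
  push_cast
  rfl

/-- At most one root counts a given cell. An entry equal to its row index is counted by none, and
then the right-hand side is zero as well. -/
theorem sum_vec_eq (T : BarTableau n μ) {x : ℕ × ℕ} (hx : x ∈ μ) :
    (∑ p : {p : Fin n × Fin n // p.1 < p.2},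
      (if x.1 = n - 1 - p.1.2 ∧ T.entry x.1 x.2 = n - 1 - p.1.1 then (1 : ℤ) else 0) •
        PosRoot.vec (Sum.inr p)) = eps n (n - 1 - T.entry x.1 x.2) - eps n (n - 1 - x.1) := by
  have h1 := T.le_entry hx
  have h2 := T.entry_lt hx
  rcases h1.eq_or_lt with h | h
  · rw [← h, sub_self]
    refine Finset.sum_eq_zero fun p _ => ?_
    have hp : (p.1.1 : ℕ) < p.1.2 := p.2
    have := p.1.2.2
    rw [if_neg (by omega), zero_smul]
  · rw [Finset.sum_eq_single
      ⟨(⟨n - 1 - T.entry x.1 x.2, by omega⟩, ⟨n - 1 - x.1, by omega⟩), by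
        simp only [Fin.mk_lt_mk]; omega⟩]
    · simp only
      rw [if_pos (by omega), one_smul]
      rfl
    · rintro ⟨⟨⟨i, hi⟩, ⟨j, hj⟩⟩, hij⟩ _ hne
      simp only [ne_eq, Subtype.mk.injEq, Prod.mk.injEq, Fin.mk.injEq] at hne ⊢
      simp only [Fin.mk_lt_mk] at hij
      rw [if_neg (by omega), zero_smul]
    · simp

theorem sum_eps_row (n : ℕ) (μ : YoungDiagram) (hμ : ∀ x ∈ μ, x.1 < n) :
    ∑ x ∈ μ.cells, eps n (n - 1 - x.1) = -shapeWeight n μ := by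
  funext k
  simp only [Finset.sum_apply, shapeWeight, Pi.neg_apply, neg_neg, YoungDiagram.rowLen_eq_card,
    YoungDiagram.row, Finset.card_filter, eps]
  push_cast
  refine Finset.sum_congr rfl fun x hx => ?_
  have h1 := hμ x hx
  have h2 := k.2
  have : ((k : ℕ) = n - 1 - x.1) ↔ x.1 = n - 1 - k := by omega
  simp only [this]

/-- Summing the contributions of the cells, the part that depends only on the row of the cell is
cancelled by the shift ε_μ. -/
theorem wt_tableauDatum (T : BarTableau n μ) :
    LusztigDatum.wt (tableauDatum T) + shapeWeight n μ = T.wt := by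
  have h1 : ∑ r, (tableauDatum T r : ℤ) • PosRoot.vec r =
      ∑ x ∈ μ.cells, (eps n (n - 1 - T.entry x.1 x.2) - eps n (n - 1 - x.1)) := by
    rw [Fintype.sum_sum_type, Finset.sum_eq_zero (fun p _ => by simp [tableauDatum]), zero_add,
      -- Double counting over pairs of a cell and a root.
      Finset.sum_congr rfl fun x hx => (T.sum_vec_eq hx).symm, Finset.sum_comm]
    refine Finset.sum_congr rfl fun p _ => ?_
    rw [← Finset.sum_smul, ← rowCount_eq_sum]
    rfl
  rw [LusztigDatum.wt, h1, Finset.sum_sub_distrib, sum_eps_row n μ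
    fun x hx => (T.le_entry hx).trans_lt (T.entry_lt hx), BarTableau.wt]
  abel

/-- The number of entries of row `r` that are at least `w` determines where they are. -/
theorem le_entry_iff (T : BarTableau n μ) {r c : ℕ} (h : (r, c) ∈ μ) (w : ℕ) :
    w ≤ T.entry r c ↔
      μ.rowLen r ≤ c + ((μ.row r).filter fun x => w ≤ T.entry x.1 x.2).card := by
  have hc := YoungDiagram.mem_iff_lt_rowLen.1 h
  constructor
  · intro hw
    have hsub : (Finset.Ico c (μ.rowLen r)).image (fun j => (r, j)) ⊆
        (μ.row r).filter fun x => w ≤ T.entry x.1 x.2 := by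
      intro x hx
      obtain ⟨j, hj, rfl⟩ := Finset.mem_image.1 hx
      rw [Finset.mem_Ico] at hj
      have hm := YoungDiagram.mem_iff_lt_rowLen.2 hj.2
      rw [Finset.mem_filter, YoungDiagram.mk_mem_row_iff]
      exact ⟨hm, hw.trans (T.1.row_weak_of_le hj.1 hm)⟩
    have := Finset.card_le_card hsub
    rw [Finset.card_image_of_injective _ (fun a b hab => (Prod.mk.inj hab).2),
      Nat.card_Ico] at this
    omega
  · intro hle
    by_contra hw
    have hsub : ((μ.row r).filter fun x => w ≤ T.entry x.1 x.2) ⊆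
        (Finset.Ico (c + 1) (μ.rowLen r)).image (fun j => (r, j)) := by
      rintro ⟨r', j⟩ hx
      rw [Finset.mem_filter, YoungDiagram.mem_row_iff] at hx
      obtain ⟨⟨hm, rfl⟩, hwx⟩ := hx
      have hj := YoungDiagram.mem_iff_lt_rowLen.1 hm
      refine Finset.mem_image.2 ⟨j, Finset.mem_Ico.2 ⟨?_, hj⟩, rfl⟩
      by_contra hjc
      have : T.entry r' j ≤ T.entry r' c := T.1.row_weak_of_le (by omega) h
      simp only at hwx
      change ¬ w ≤ T.entry r' c at hw
      omega
    have := Finset.card_le_card hsub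
    rw [Finset.card_image_of_injective _ (fun a b hab => (Prod.mk.inj hab).2),
      Nat.card_Ico] at this
    omega

theorem card_le_entry_eq_sum (T : BarTableau n μ) (r w : ℕ) :
    ((μ.row r).filter fun x => w ≤ T.entry x.1 x.2).card =
      ∑ v ∈ Finset.Ico w n, T.rowCount r v := by
  rw [Finset.card_eq_sum_card_fiberwise (f := fun x => T.entry x.1 x.2) (t := Finset.Ico w n)]
  · refine Finset.sum_congr rfl fun v hv => ?_
    rw [Finset.mem_Ico] at hv
    rw [rowCount, Finset.filter_filter]
    congr 1
    refine Finset.filter_congr fun x _ => ?_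
    omega
  · intro x hx
    simp only [Finset.coe_filter, Set.mem_ofPred_eq, YoungDiagram.mem_row_iff] at hx
    rw [Finset.mem_coe, Finset.mem_Ico]
    exact ⟨hx.2, T.entry_lt hx.1.1⟩

/-- A row is weakly increasing, so the numbers of its entries ≥ w locate every entry; for w > r
these numbers are sums of multiplicities of the datum. -/
theorem tableauDatum_injective :
    Function.Injective (tableauDatum : BarTableau n μ → LusztigDatum n) := by
  intro T T' h
  have hcount : ∀ r v, r < v → v < n → T.rowCount r v = T'.rowCount r v := by
    intro r v hrv hv
    have hlt : (⟨n - 1 - v, by omega⟩ : Fin n) < ⟨n - 1 - r, by omega⟩ :=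
      Fin.mk_lt_mk.2 (by omega)
    have h1 := congrFun h (diffRoot _ _ hlt)
    rw [tableauDatum_diffRoot, tableauDatum_diffRoot] at h1
    have e1 : n - 1 - (n - 1 - r) = r := by omega
    have e2 : n - 1 - (n - 1 - v) = v := by omega
    simpa only [e1, e2] using h1
  have key : ∀ r c w, (r, c) ∈ μ → (w ≤ T.entry r c ↔ w ≤ T'.entry r c) := by
    intro r c w hm
    -- The datum does not record the entries equal to `r`, but for w ≤ r both inequalities hold
    -- anyway.
    by_cases hw : w ≤ r
    · exact ⟨fun _ => hw.trans (T'.le_entry hm), fun _ => hw.trans (T.le_entry hm)⟩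
    · rw [T.le_entry_iff hm, T'.le_entry_iff hm, card_le_entry_eq_sum, card_le_entry_eq_sum,
        Finset.sum_congr rfl fun v hv => ?_]
      rw [Finset.mem_Ico] at hv
      exact hcount r v (by omega) hv.2
  refine ext_entry fun r c => ?_
  by_cases hm : (r, c) ∈ μ
  · exact le_antisymm ((key r c _ hm).1 le_rfl) ((key r c _ hm).2 le_rfl)
  · exact (T.1.zeros hm).trans (T'.1.zeros hm).symm

end BarTableau

/-! ### Comparing the column reading with row heights -/

namespace BarTableau

variable {n : ℕ} {μ : YoungDiagram}

instance (x y : ℕ × ℕ) : Decidable (readsBefore x y) :=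
  inferInstanceAs (Decidable (y.2 < x.2 ∨ (x.2 = y.2 ∧ x.1 < y.1)))

theorem signHeight_eq_card (T : BarTableau n μ) {i : Fin n} {v : ℕ} (hv : v + i + 2 = n)
    {L : List (ℕ × ℕ)} (hL : L.Nodup) (S : Finset (ℕ × ℕ)) (hS : ∀ z, z ∈ L ↔ z ∈ S) :
    signHeight (T.sign i) L = ((S.filter fun z => T.entry z.1 z.2 = v + 1).card : ℤ) -
      (S.filter fun z => T.entry z.1 z.2 = v).card := by
  have hLS : L.toFinset = S := by
    ext z
    rw [List.mem_toFinset, hS]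
  rw [signHeight, ← List.sum_toFinset _ hL, hLS, Finset.card_filter, Finset.card_filter]
  push_cast
  rw [← Finset.sum_sub_distrib]
  refine Finset.sum_congr rfl fun z _ => ?_
  unfold sign
  split_ifs <;> first | omega | simp

/-- For letters `v` (sign `+`) and `v + 1` (sign `-`), the height of the row reading word just after
the signs `-` of row `r`. -/
def rowHeight (T : BarTableau n μ) (v r : ℕ) : ℤ :=
  ∑ k ∈ Finset.range (r + 1), (T.rowCount k (v + 1) : ℤ) -
    ∑ k ∈ Finset.range r, (T.rowCount k v : ℤ)

theorem rowHeight_zero (T : BarTableau n μ) (v : ℕ) :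
    T.rowHeight v 0 = T.rowCount 0 (v + 1) := by
  simp [rowHeight]

theorem rowHeight_succ (T : BarTableau n μ) (v r : ℕ) :
    T.rowHeight v (r + 1) = T.rowHeight v r - T.rowCount r v + T.rowCount (r + 1) (v + 1) := by
  simp only [rowHeight, Finset.sum_range_succ]
  ring

theorem sum_rowCount (T : BarTableau n μ) (v m : ℕ) :
    ∑ k ∈ Finset.range m, (T.rowCount k v : ℤ) =
      (μ.cells.filter fun z => z.1 < m ∧ T.entry z.1 z.2 = v).card := by
  rw [Finset.card_eq_sum_card_fiberwise (f := fun z => z.1) (t := Finset.range m)]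
  · push_cast
    refine Finset.sum_congr rfl fun k hk => ?_
    rw [Finset.mem_range] at hk
    rw [rowCount, YoungDiagram.row, Finset.filter_filter, Finset.filter_filter]
    congr 2
    refine Finset.filter_congr fun x _ => ?_
    omega
  · intro x hx
    simp only [Finset.coe_filter, Set.mem_ofPred_eq] at hx
    rw [Finset.mem_coe, Finset.mem_range]
    exact hx.2.1

theorem row_le (T : BarTableau n μ) {r c c' : ℕ} (hc : c ≤ c') (h : (r, c') ∈ μ) :
    T.entry r c ≤ T.entry r c' := T.1.row_weak_of_le hc h

theorem col_lt (T : BarTableau n μ) {r r' c : ℕ} (hr : r < r') (h : (r', c) ∈ μ) :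
    T.entry r c < T.entry r' c := T.1.col_strict hr h

theorem mem_of_le {r c r' c' : ℕ} (h : (r', c') ∈ μ) (hr : r ≤ r') (hc : c ≤ c') :
    (r, c) ∈ μ := μ.up_left_mem hr hc h

/-- The height of the reading word after a sign `-` in row `r`. -/
theorem signHeight_of_neg (T : BarTableau n μ) {i : Fin n} {v : ℕ} (hv : v + i + 2 = n)
    {A B : List (ℕ × ℕ)} {r c : ℕ} (hl : readingCells μ = A ++ (r, c) :: B)
    (hy : T.entry r c = v + 1) :
    signHeight (T.sign i) (A ++ [(r, c)]) ≤ T.rowHeight v r ∧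
      ((∀ j < c, T.entry r j ≠ v + 1) →
        signHeight (T.sign i) (A ++ [(r, c)]) = T.rowHeight v r) := by
  have hyμ : (r, c) ∈ μ := mem_readingCells.1 (by rw [hl]; simp)
  have hnd : (A ++ [(r, c)]).Nodup := by
    have := readingCells_nodup μ
    rw [hl, List.append_cons] at this
    exact this.of_append_left
  have hmem : ∀ z, z ∈ A ++ [(r, c)] ↔
      z ∈ μ.cells.filter fun z => ¬ readsBefore (r, c) z := by
    intro z
    have hpw := readingCells_pairwise μ
    rw [hl, List.pairwise_append, List.pairwise_cons] at hpw
    obtain ⟨-, ⟨hB, -⟩, hA⟩ := hpw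
    rw [Finset.mem_filter, YoungDiagram.mem_cells, ← mem_readingCells, hl]
    simp only [List.mem_append, List.mem_cons, List.not_mem_nil, or_false]
    constructor
    · rintro (h | rfl)
      · exact ⟨Or.inl h, readsBefore_asymm _ _ (hA z h _ List.mem_cons_self)⟩
      · exact ⟨Or.inr (Or.inl rfl), fun h => readsBefore_asymm _ _ h h⟩
    · rintro ⟨h | h | h, hz⟩
      · exact Or.inl h
      · exact Or.inr h
      · exact absurd (hB z h) hz
  -- Entries `v + 1` in rows above `r` lie to the right of column `c`, and those in rows below lie
  -- to its left. So the prefix misses, among those of rows up to `r`, only the ones in row `r` left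
  -- of `c`.
  have hneg : (μ.cells.filter fun z => z.1 < r + 1 ∧ T.entry z.1 z.2 = v + 1).card =
      ((μ.cells.filter fun z => ¬ readsBefore (r, c) z).filter
        fun z => T.entry z.1 z.2 = v + 1).card +
      (μ.cells.filter fun z => z.1 = r ∧ z.2 < c ∧ T.entry z.1 z.2 = v + 1).card := by
    rw [Finset.filter_filter, ← Finset.card_union_of_disjoint, ← Finset.filter_or]
    · congr 1
      refine Finset.filter_congr ?_
      rintro ⟨a, b⟩ hz
      simp only [YoungDiagram.mem_cells] at hz
      simp only [readsBefore]
      constructor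
      · rintro ⟨h1, h2⟩
        by_cases hb : b < c
        · by_cases ha : a < r
          · have hm := mem_of_le hyμ (le_refl r) hb.le
            have e1 := T.col_lt ha hm
            have e2 := T.row_le hb.le hyμ
            omega
          · exact Or.inr ⟨by omega, hb, h2⟩
        · exact Or.inl ⟨by omega, h2⟩
      · rintro (⟨h1, h2⟩ | ⟨h1, h2, h3⟩)
        · refine ⟨?_, h2⟩
          by_contra ha
          have hm := mem_of_le hz (show r ≤ a by omega) (le_refl b)
          have e1 := T.col_lt (show r < a by omega) hz
          have e2 := T.row_le (show c ≤ b by omega) hm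
          omega
        · exact ⟨by omega, h3⟩
    · rw [Finset.disjoint_filter]
      rintro ⟨a, b⟩ _ h1 h2
      simp only [readsBefore] at h1 h2
      omega
  -- Likewise the prefix contains no `v` from row `r` or below, and misses only the `v` above row
  -- `r` in columns left of `c`.
  have hpos : (μ.cells.filter fun z => z.1 < r ∧ T.entry z.1 z.2 = v).card =
      ((μ.cells.filter fun z => ¬ readsBefore (r, c) z).filter
        fun z => T.entry z.1 z.2 = v).card +
      (μ.cells.filter fun z => z.1 < r ∧ z.2 < c ∧ T.entry z.1 z.2 = v).card := by
    rw [Finset.filter_filter, ← Finset.card_union_of_disjoint, ← Finset.filter_or]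
    · congr 1
      refine Finset.filter_congr ?_
      rintro ⟨a, b⟩ hz
      simp only [YoungDiagram.mem_cells] at hz
      simp only [readsBefore]
      constructor
      · rintro ⟨h1, h2⟩
        by_cases hb : b < c
        · exact Or.inr ⟨h1, hb, h2⟩
        · exact Or.inl ⟨by omega, h2⟩
      · rintro (⟨h1, h2⟩ | ⟨h1, h2, h3⟩)
        · refine ⟨?_, h2⟩
          by_contra ha
          have hm := mem_of_le hz (show r ≤ a by omega) (le_refl b)
          have e2 := T.row_le (show c ≤ b by omega) hm
          rcases (show r = a ∨ r < a by omega) with rfl | hra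
          · omega
          · have e1 := T.col_lt hra hz
            omega
        · exact ⟨h1, h3⟩
    · rw [Finset.disjoint_filter]
      rintro ⟨a, b⟩ _ h1 h2
      simp only [readsBefore] at h1 h2
      omega
  -- Below a missed `v`, the entry in row `r` is more than `v` and at most `v + 1`. Going down the
  -- column therefore sends missed `+` injectively to missed `-`.
  have hinj : (μ.cells.filter fun z => z.1 < r ∧ z.2 < c ∧ T.entry z.1 z.2 = v).card ≤
      (μ.cells.filter fun z => z.1 = r ∧ z.2 < c ∧ T.entry z.1 z.2 = v + 1).card := by
    refine Finset.card_le_card_of_injOn (fun z => (r, z.2)) ?_ ?_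
    · rintro ⟨a, b⟩ hz
      simp only [Finset.coe_filter, Set.mem_ofPred_eq, YoungDiagram.mem_cells] at hz ⊢
      obtain ⟨-, h1, h2, h3⟩ := hz
      have hm := mem_of_le hyμ (le_refl r) h2.le
      have e1 := T.col_lt h1 hm
      have e2 := T.row_le h2.le hyμ
      exact ⟨hm, trivial, h2, by omega⟩
    · rintro ⟨a, b⟩ hz ⟨a', b'⟩ hz' h
      simp only [Finset.coe_filter, Set.mem_ofPred_eq, YoungDiagram.mem_cells] at hz hz'
      obtain rfl : b = b' := (Prod.mk.inj h).2
      rcases lt_trichotomy a a' with ha | rfl | ha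
      · have := T.col_lt ha hz'.1
        omega
      · rfl
      · have := T.col_lt ha hz.1
        omega
  rw [T.signHeight_eq_card hv hnd _ hmem, rowHeight, sum_rowCount, sum_rowCount]
  refine ⟨by omega, fun hleft => ?_⟩
  have h0 : (μ.cells.filter fun z => z.1 = r ∧ z.2 < c ∧ T.entry z.1 z.2 = v + 1).card = 0 := by
    rw [Finset.card_eq_zero, Finset.filter_eq_empty_iff]
    rintro ⟨a, b⟩ _ ⟨h1, h2, h3⟩
    simp only at h1 h2 h3
    subst h1
    exact hleft b h2 h3
  omega

/-- The leftmost entry `v` of a row. -/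
theorem exists_leftmost (T : BarTableau n μ) {r v : ℕ} (h : T.rowCount r v ≠ 0) :
    ∃ c, (r, c) ∈ μ ∧ T.entry r c = v ∧ ∀ j < c, T.entry r j ≠ v := by
  have hex : ∃ c, (r, c) ∈ μ ∧ T.entry r c = v := by
    obtain ⟨⟨a, b⟩, hx⟩ := Finset.card_ne_zero.1 h
    rw [Finset.mem_filter, YoungDiagram.mem_row_iff] at hx
    obtain ⟨⟨hm, rfl⟩, hb⟩ := hx
    exact ⟨b, hm, hb⟩
  classical
  refine ⟨Nat.find hex, (Nat.find_spec hex).1, (Nat.find_spec hex).2, fun j hj hv => ?_⟩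
  exact Nat.find_min hex hj ⟨mem_of_le (Nat.find_spec hex).1 le_rfl hj.le, hv⟩

/-- If row `r` contains `v + 1`, its row height is the height of an actual prefix. Otherwise it does
not exceed the height of the preceding row, or is zero for the top row. -/
theorem rowHeight_le (T : BarTableau n μ) {i : Fin n} {v : ℕ} (hv : v + i + 2 = n) (r : ℕ) :
    T.rowHeight v r ≤ unmatchedNeg (T.sign i) (readingCells μ) := by
  by_cases h : T.rowCount r (v + 1) = 0
  · cases r with
    | zero =>
      rw [rowHeight_zero, h]
      omega
    | succ r =>
      have ih := T.rowHeight_le hv r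
      rw [rowHeight_succ, h]
      omega
  · obtain ⟨c, hm, hc, hleft⟩ := T.exists_leftmost h
    obtain ⟨A, B, hl⟩ := List.append_of_mem (mem_readingCells.2 hm)
    rw [← (T.signHeight_of_neg hv hl hc).2 hleft, hl, List.append_cons A (r, c) B]
    exact signHeight_le _ _ _

/-- Above an entry `v + 1` in row `v + 1` there must stand a `v`, since entries of row `v` are at
least `v`. -/
theorem rowCount_succ_le (T : BarTableau n μ) (v : ℕ) :
    T.rowCount (v + 1) (v + 1) ≤ T.rowCount v v := by
  refine Finset.card_le_card_of_injOn (fun z => (v, z.2)) ?_ ?_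
  · rintro ⟨a, b⟩ hz
    simp only [Finset.coe_filter, Set.mem_ofPred_eq, YoungDiagram.mem_row_iff] at hz ⊢
    obtain ⟨⟨hm, rfl⟩, h⟩ := hz
    have hm' := mem_of_le hm (Nat.le_succ v) le_rfl
    have e1 := T.col_lt (Nat.lt_succ_self v) hm
    have e2 := T.le_entry hm'
    simp only [Nat.succ_eq_add_one] at *
    exact ⟨⟨hm', trivial⟩, by omega⟩
  · rintro ⟨a, b⟩ hz ⟨a', b'⟩ hz' h
    simp only [Finset.coe_filter, Set.mem_ofPred_eq, YoungDiagram.mem_row_iff] at hz hz'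
    rw [Prod.mk.injEq] at h
    rw [Prod.mk.injEq, hz.1.2, hz'.1.2]
    exact ⟨rfl, h.2⟩

/-- The bound `r ≤ v` matters because the braid moves see no row beyond `v`. An entry `v + 1` can
also occur in row `v + 1`, but by `rowCount_succ_le` that row is no higher than row `v`. -/
theorem exists_le_rowHeight (T : BarTableau n μ) {i : Fin n} {v : ℕ} (hv : v + i + 2 = n) :
    ∃ r ≤ v, (unmatchedNeg (T.sign i) (readingCells μ) : ℤ) ≤ T.rowHeight v r := by
  rcases exists_signHeight_eq (T.sign i) (readingCells μ) with h | ⟨A, ⟨r, c⟩, B, hl, hs, h⟩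
  · refine ⟨0, Nat.zero_le _, ?_⟩
    rw [h, rowHeight_zero]
    omega
  · have hy : T.entry r c = v + 1 := by
      have := sign_eq_neg_one_iff.1 hs
      simp only at this
      omega
    have hle := (T.signHeight_of_neg hv hl hy).1
    rw [← h] at hle
    have hr : r ≤ v + 1 := by
      have := T.le_entry (mem_readingCells.1 (show (r, c) ∈ readingCells μ by rw [hl]; simp))
      omega
    rcases hr.lt_or_eq with hr | rfl
    · exact ⟨r, by omega, hle⟩
    · refine ⟨v, le_rfl, ?_⟩
      have := T.rowCount_succ_le v
      rw [rowHeight_succ] at hle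
      omega

/-- The row in which `f̃` acts is the last one of maximal height. -/
theorem IsRaise.rowHeight {i : Fin n} {v : ℕ} (hv : v + i + 2 = n) {T T' : BarTableau n μ}
    {r c : ℕ} (h : IsRaise i T T' (r, c)) :
    (r, c) ∈ μ ∧ T.entry r c = v ∧
      T.rowHeight v r = unmatchedNeg (T.sign i) (readingCells μ) ∧
      ∀ k, r < k → T.rowHeight v k < unmatchedNeg (T.sign i) (readingCells μ) := by
  obtain ⟨A, B, hl, hs, hA, hB⟩ := firstUnmatchedPos_eq_some_iff.1 h.first
  obtain ⟨hm, -, -, hright, -, hbelow⟩ := T.raise_spec i (r, c) h.first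
  have hx : T.entry r c = v := by
    have := sign_eq_one_iff.1 hs
    simp only at this
    omega
  simp only [hx] at hright hbelow
  have hneg0 : unmatchedNeg (T.sign i) ((r, c) :: B) = 0 := by simp [unmatchedNeg, hs, hB]
  -- No `+` remains before the cell and no `-` remains from it on, so the maximal height is reached
  -- just before the cell.
  have heps : (unmatchedNeg (T.sign i) (readingCells μ) : ℤ) = signHeight (T.sign i) A := by
    rw [hl, unmatchedNeg_append, signHeight_eq, hA, hneg0]
    simp
  have hmemA : ∀ z, z ∈ A ↔ z ∈ μ.cells.filter fun z => readsBefore z (r, c) := by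
    intro z
    have hpw := readingCells_pairwise μ
    rw [hl, List.pairwise_append, List.pairwise_cons] at hpw
    obtain ⟨-, ⟨hB, -⟩, hA⟩ := hpw
    rw [Finset.mem_filter, YoungDiagram.mem_cells, ← mem_readingCells, hl]
    simp only [List.mem_append, List.mem_cons]
    constructor
    · intro h
      exact ⟨Or.inl h, hA z h _ List.mem_cons_self⟩
    · rintro ⟨h | rfl | h, hz⟩
      · exact h
      · exact absurd hz (readsBefore_asymm _ _ hz)
      · exact absurd hz (readsBefore_asymm _ _ (hB z h))
  have hndA : A.Nodup := by
    have := readingCells_nodup μ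
    rw [hl] at this
    exact this.of_append_left
  -- Right of the cell in its row the entries exceed `v`, and below it in its column they exceed `v
  -- + 1`. So before it are read exactly the `v + 1` of rows up to `r` and the `v` of rows above
  -- `r`.
  have hK : T.rowHeight v r = unmatchedNeg (T.sign i) (readingCells μ) := by
    rw [heps, T.signHeight_eq_card hv hndA _ hmemA, BarTableau.rowHeight, sum_rowCount,
      sum_rowCount, Finset.filter_filter, Finset.filter_filter]
    congr 3
    · refine Finset.filter_congr ?_
      rintro ⟨a, b⟩ hz
      simp only [YoungDiagram.mem_cells] at hz
      simp only [readsBefore]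
      constructor
      · rintro ⟨h1, h2⟩
        refine ⟨Or.inl ?_, h2⟩
        by_contra hb
        have hm' := mem_of_le hm le_rfl (show b ≤ c by omega)
        have e1 := T.row_le (show b ≤ c by omega) hm
        rcases (show a = r ∨ a < r by omega) with rfl | ha
        · omega
        · have e2 := T.col_lt ha hm'
          omega
      · rintro ⟨h1, h2⟩
        refine ⟨?_, h2⟩
        by_contra ha
        have e1 := hbelow a (by omega) (mem_of_le hz le_rfl (by omega))
        have e2 := T.row_le (show c ≤ b by omega) hz
        omega
    · refine Finset.filter_congr ?_
      rintro ⟨a, b⟩ hz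
      simp only [YoungDiagram.mem_cells] at hz
      simp only [readsBefore]
      constructor
      · rintro ⟨h1, h2⟩
        refine ⟨Or.inl ?_, h2⟩
        by_contra hb
        have hm' := mem_of_le hm le_rfl (show b ≤ c by omega)
        have e1 := T.row_le (show b ≤ c by omega) hm
        have e2 := T.col_lt h1 hm'
        omega
      · rintro ⟨h1, h2⟩
        refine ⟨?_, h2⟩
        by_contra ha
        rcases (show a = r ∨ r < a by omega) with rfl | ha
        · have e1 := hright b (by omega) hz
          omega
        · have e1 := hbelow a ha (mem_of_le hz le_rfl (by omega))
          have e2 := T.row_le (show c ≤ b by omega) hz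
          omega
  refine ⟨hm, hx, hK, fun k hk => ?_⟩
  have hpos : 0 < T.rowCount r v :=
    Finset.card_pos.2 ⟨(r, c), Finset.mem_filter.2 ⟨YoungDiagram.mk_mem_row_iff.2 hm, hx⟩⟩
  -- The leftmost `v + 1` of row `k` is read after the selected `+`, which costs one, and the rest
  -- of the word cannot regain it because no `-` remains there.
  have hminus : ∀ k, r < k → T.rowCount k (v + 1) ≠ 0 →
      T.rowHeight v k < unmatchedNeg (T.sign i) (readingCells μ) := by
    intro k hk h0
    obtain ⟨b, hkb, hb, hleft⟩ := T.exists_leftmost h0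
    have hnot : ¬ readsBefore (k, b) (r, c) := by
      simp only [readsBefore]
      intro hrb
      have e1 := hbelow k hk (mem_of_le hkb le_rfl (by omega))
      have e2 := T.row_le (show c ≤ b by omega) hkb
      omega
    have hmB : (k, b) ∈ B := by
      have hkl := mem_readingCells.2 hkb
      rw [hl, List.mem_append, List.mem_cons] at hkl
      rcases hkl with h | h | h
      · rw [hmemA, Finset.mem_filter] at h
        exact absurd h.2 hnot
      · rw [Prod.mk.injEq] at h
        omega
      · exact h
    obtain ⟨B₁, B₂, rfl⟩ := List.append_of_mem hmB
    have hl' : readingCells μ = (A ++ (r, c) :: B₁) ++ (k, b) :: B₂ := by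
      rw [hl, List.append_assoc, List.cons_append]
    have hle := signHeight_le (T.sign i) (B₁ ++ [(k, b)]) B₂
    rw [List.append_assoc, List.singleton_append, hB] at hle
    rw [← (T.signHeight_of_neg hv hl' hb).2 hleft, heps, List.append_assoc, List.cons_append,
      signHeight_append, signHeight_cons, hs]
    simp only [SignType.coe_one]
    push_cast at hle
    omega
  -- Rows without `v + 1` cannot raise the height. In the first row after `r` the drop is strict
  -- because row `r` contains a `v`.
  induction k, hk using Nat.le_induction with
  | base =>
    by_cases h0 : T.rowCount (r + 1) (v + 1) = 0
    · rw [rowHeight_succ, h0]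
      omega
    · exact hminus _ (Nat.lt_succ_self r) h0
  | succ k hk ih =>
    by_cases h0 : T.rowCount (k + 1) (v + 1) = 0
    · rw [rowHeight_succ, h0]
      omega
    · exact hminus _ (by omega) h0

end BarTableau

/-! ### The braid moves among the roots ε_a - ε_b -/

section DiffFold

variable {n : ℕ} {p q : Fin n} {hpq : p < q}

/-- The braid move that exchanges `ε_q - ε_m`, `ε_p - ε_m`, `ε_p - ε_q`, if `q < m`. -/
def diffStep (p q : Fin n) (hpq : p < q) (m : ℕ) (d : LusztigDatum n) : LusztigDatum n :=
  if h : ∃ hm : m < n, q < ⟨m, hm⟩ then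
    braidMove (diffRoot q ⟨m, h.1⟩ h.2, diffRoot p ⟨m, h.1⟩ (hpq.trans h.2), diffRoot p q hpq) d
  else d

/-- The result of the braid moves of `diffTriples` for `k < m`. -/
def diffFold (p q : Fin n) (hpq : p < q) (c : LusztigDatum n) : ℕ → LusztigDatum n
  | 0 => c
  | m + 1 => diffStep p q hpq m (diffFold p q hpq c m)

theorem foldl_range_diffStep (c : LusztigDatum n) (m : ℕ) :
    (List.range m).foldl (fun d k => diffStep p q hpq k d) c = diffFold p q hpq c m := by
  induction m with
  | zero => rfl
  | succ m ih => rw [List.range_succ, List.foldl_append, ih]; rfl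

theorem foldl_diffTriples (c : LusztigDatum n) :
    (diffTriples p q hpq).foldl (fun d t => braidMove t d) c = diffFold p q hpq c n := by
  rw [← foldl_range_diffStep, ← List.map_coe_finRange_eq_range, List.foldl_map, diffTriples,
    List.foldl_filterMap]
  congr 1
  funext d k
  by_cases h : q < k
  · simp [diffStep, h]
  · simp [diffStep, h]

theorem diffFold_of_le (c : LusztigDatum n) {m : ℕ} (hm : m ≤ q + 1) :
    diffFold p q hpq c m = c := by
  induction m with
  | zero => rfl
  | succ m ih =>
    rw [diffFold, ih (by omega)]
    refine dif_neg ?_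
    rintro ⟨h1, h2⟩
    rw [Fin.lt_def] at h2
    simp only at h2
    omega

theorem diffFold_succ (c : LusztigDatum n) (k : Fin n) (hk : q < k) :
    diffFold p q hpq c (k + 1) =
      braidMove (diffRoot q k hk, diffRoot p k (hpq.trans hk), diffRoot p q hpq)
        (diffFold p q hpq c k) :=
  dif_pos ⟨k.2, hk⟩

theorem isBraidTriple_diff (hpq : p < q) (k : Fin n) (hk : q < k) :
    IsBraidTriple (diffRoot q k hk, diffRoot p k (hpq.trans hk), diffRoot p q hpq) := by
  refine ⟨?_, ?_, ?_, ?_⟩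
  · simp [hpq.ne']
  · simp [hpq.ne']
  · simp [hk.ne']
  · simp only [PosRoot.vec]
    abel

/-- The moves with index below `k` alter only roots whose second index is below `k`, so each move
meets its two roots involving `k` unaltered. -/
theorem diffFold_apply_of_le (c : LusztigDatum n) {m : ℕ} {j k : Fin n} (hjk : j < k)
    (hm : m ≤ k) (hk : q < k) :
    diffFold p q hpq c m (diffRoot j k hjk) = c (diffRoot j k hjk) := by
  induction m with
  | zero => rfl
  | succ m ih =>
    by_cases h : (q : ℕ) < m
    · rw [diffFold_succ (k := ⟨m, by omega⟩) (hk := h), braidMove_of_ne, ih (by omega)]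
      · simp only [ne_eq, Sum.inr.injEq, Subtype.mk.injEq, Prod.mk.injEq, Fin.ext_iff]
        omega
      · simp only [ne_eq, Sum.inr.injEq, Subtype.mk.injEq, Prod.mk.injEq, Fin.ext_iff]
        omega
      · simp only [ne_eq, Sum.inr.injEq, Subtype.mk.injEq, Prod.mk.injEq, Fin.ext_iff]
        omega
    · rw [diffFold_of_le _ (by omega)]

/-- From b + c - min a b = c + max(b - a, 0), the maximum being the truncated subtraction. -/
theorem diffFold_succ_apply (c : LusztigDatum n) (k : Fin n) (hk : q < k) :
    diffFold p q hpq c (k + 1) (diffRoot p q hpq) = c (diffRoot p k (hpq.trans hk)) +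
      (diffFold p q hpq c k (diffRoot p q hpq) - c (diffRoot q k hk)) := by
  have h := braidMove_thd (isBraidTriple_diff hpq k hk) (diffFold p q hpq c k)
  rw [diffFold_succ (hk := hk), h]
  simp only [diffFold_apply_of_le c _ le_rfl hk]
  omega

theorem braidMove_congr {t : PosRoot n × PosRoot n × PosRoot n} {c d : LusztigDatum n}
    (h1 : c t.1 = d t.1) (h2 : c t.2.1 = d t.2.1) (h3 : c t.2.2 = d t.2.2) {r : PosRoot n}
    (hr : c r = d r) : braidMove t c r = braidMove t d r := by
  simp only [braidMove, h1, h2, h3, hr]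

/-- If a ≤ b, the minimum stays equal to a when b grows, so the extra unit remains on the third
root. -/
theorem braidMove_update {t : PosRoot n × PosRoot n × PosRoot n} (ht : IsBraidTriple t)
    (c : LusztigDatum n) (h : c t.1 ≤ c t.2.2) :
    braidMove t (Function.update c t.2.2 (c t.2.2 + 1)) =
      Function.update (braidMove t c) t.2.2 (braidMove t c t.2.2 + 1) := by
  set c' := Function.update c t.2.2 (c t.2.2 + 1) with hc'
  have e1 : c' t.1 = c t.1 := Function.update_of_ne ht.ne₁₃ _ _
  have e2 : c' t.2.1 = c t.2.1 := Function.update_of_ne ht.ne₂₃ _ _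
  have e3 : c' t.2.2 = c t.2.2 + 1 := Function.update_self _ _ _
  funext r
  by_cases h3 : r = t.2.2
  · subst h3
    rw [Function.update_self, braidMove_thd ht, braidMove_thd ht, e1, e2, e3]
    omega
  rw [Function.update_of_ne h3]
  by_cases h1 : r = t.1
  · subst h1
    rw [braidMove_fst, braidMove_fst, e1, e2, e3]
    omega
  by_cases h2 : r = t.2.1
  · subst h2
    rw [braidMove_snd ht, braidMove_snd ht, e1, e3]
    omega
  · rw [braidMove_of_ne _ h1 h2 h3, braidMove_of_ne _ h1 h2 h3]
    exact Function.update_of_ne h3 _ _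

theorem diffFold_update_of_le {c c' : LusztigDatum n} {m₀ m : ℕ} (h₀ : (q : ℕ) < m₀)
    (hm : m₀ ≤ m) (hmn : m ≤ n)
    (h : diffFold p q hpq c' m₀ = Function.update (diffFold p q hpq c m₀) (diffRoot p q hpq)
      (diffFold p q hpq c m₀ (diffRoot p q hpq) + 1))
    (hle : ∀ k : Fin n, ∀ hk : q < k, m₀ ≤ k →
      c (diffRoot q k hk) ≤ diffFold p q hpq c k (diffRoot p q hpq)) :
    diffFold p q hpq c' m = Function.update (diffFold p q hpq c m) (diffRoot p q hpq)
      (diffFold p q hpq c m (diffRoot p q hpq) + 1) := by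
  induction m, hm using Nat.le_induction with
  | base => exact h
  | succ m hm ih =>
    have hk : q < (⟨m, hmn⟩ : Fin n) := h₀.trans_le hm
    have e := diffFold_succ (hpq := hpq) c' ⟨m, hmn⟩ hk
    have e' := diffFold_succ (hpq := hpq) c ⟨m, hmn⟩ hk
    simp only at e e'
    rw [e, e', ih (by omega)]
    refine braidMove_update (isBraidTriple_diff hpq ⟨m, hmn⟩ hk) _ ?_
    have := hle ⟨m, hmn⟩ hk hm
    rwa [← diffFold_apply_of_le (hpq := hpq) c hk le_rfl hk] at this

/-- If b < a, the minimum is b before and after moving one unit from α to γ. The total on α and γ is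
also the same, so only the outgoing third multiplicity sees the change. -/
theorem braidMove_shift {t : PosRoot n × PosRoot n × PosRoot n} (ht : IsBraidTriple t)
    {c c' : LusztigDatum n} (h : c t.2.2 < c t.1) (h1 : c' t.1 + 1 = c t.1)
    (h2 : c' t.2.1 = c t.2.1 + 1) (hne : ∀ r, r ≠ t.1 → r ≠ t.2.1 → c' r = c r) :
    braidMove t c' = Function.update (braidMove t c) t.2.2 (braidMove t c t.2.2 + 1) := by
  have e3 := hne t.2.2 ht.ne₁₃.symm ht.ne₂₃.symm
  funext r
  by_cases h3 : r = t.2.2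
  · subst h3
    rw [Function.update_self, braidMove_thd ht, braidMove_thd ht]
    omega
  rw [Function.update_of_ne h3]
  by_cases h1' : r = t.1
  · subst h1'
    rw [braidMove_fst, braidMove_fst]
    omega
  by_cases h2' : r = t.2.1
  · subst h2'
    rw [braidMove_snd ht, braidMove_snd ht]
    omega
  · rw [braidMove_of_ne _ h1' h2' h3, braidMove_of_ne _ h1' h2' h3, hne r h1' h2']

/-- Earlier moves do not read the two multiplicities attached to `k`, so a change there stays
invisible until the move for `k`. -/
theorem diffFold_congr {c c' : LusztigDatum n} (k : Fin n) (hk : q < k) {m : ℕ} (hm : m ≤ k)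
    (hne : ∀ r, r ≠ diffRoot q k hk → r ≠ diffRoot p k (hpq.trans hk) → c' r = c r)
    {r : PosRoot n} (h1 : r ≠ diffRoot q k hk) (h2 : r ≠ diffRoot p k (hpq.trans hk)) :
    diffFold p q hpq c' m r = diffFold p q hpq c m r := by
  induction m generalizing r with
  | zero => exact hne r h1 h2
  | succ m ih =>
    by_cases h : (q : ℕ) < m
    · have hmn : m < n := by omega
      have e := diffFold_succ (hpq := hpq) c' ⟨m, hmn⟩ h
      have e' := diffFold_succ (hpq := hpq) c ⟨m, hmn⟩ h
      simp only at e e'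
      rw [e, e']
      have hq : (q : ℕ) < k := hk
      refine braidMove_congr (ih (by omega) ?_ ?_) (ih (by omega) ?_ ?_) (ih (by omega) ?_ ?_)
        (ih (by omega) h1 h2) <;>
      · simp only [ne_eq, Sum.inr.injEq, Subtype.mk.injEq, Prod.mk.injEq, Fin.ext_iff]
        omega
    · rw [diffFold_of_le _ (by omega), diffFold_of_le _ (by omega), hne r h1 h2]

theorem diffFold_shift {c c' : LusztigDatum n} (k : Fin n) (hk : q < k)
    (h1 : c' (diffRoot q k hk) + 1 = c (diffRoot q k hk))
    (h2 : c' (diffRoot p k (hpq.trans hk)) = c (diffRoot p k (hpq.trans hk)) + 1)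
    (hne : ∀ r, r ≠ diffRoot q k hk → r ≠ diffRoot p k (hpq.trans hk) → c' r = c r)
    (hlt : diffFold p q hpq c k (diffRoot p q hpq) < c (diffRoot q k hk)) :
    diffFold p q hpq c' (k + 1) = Function.update (diffFold p q hpq c (k + 1)) (diffRoot p q hpq)
      (diffFold p q hpq c (k + 1) (diffRoot p q hpq) + 1) := by
  rw [diffFold_succ (hk := hk), diffFold_succ (hk := hk)]
  refine braidMove_shift (isBraidTriple_diff hpq k hk) ?_ ?_ ?_
    fun r hr1 hr2 => diffFold_congr k hk le_rfl hne hr1 hr2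
  · simpa only [diffFold_apply_of_le c hk le_rfl hk] using hlt
  · simpa only [diffFold_apply_of_le _ hk le_rfl hk] using h1
  · simpa only [diffFold_apply_of_le _ (hpq.trans hk) le_rfl hk] using h2

end DiffFold

/-! ### Reduction of the transition map to Levi data -/

section Transition

variable {n : ℕ}

theorem braidMove_eq_self {t : PosRoot n × PosRoot n × PosRoot n} {c : LusztigDatum n}
    (h1 : c t.1 = 0) (h2 : c t.2.1 = 0) : braidMove t c = c := by
  funext r
  unfold braidMove
  split_ifs with e1 e2 e3
  · rw [e1]
    omega
  · rw [e2]
    omega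
  · rw [e3]
    omega
  · rfl

theorem foldl_braidMove_eq_self (l : List (PosRoot n × PosRoot n × PosRoot n))
    {c : LusztigDatum n} (h : ∀ t ∈ l, c t.1 = 0 ∧ c t.2.1 = 0) :
    l.foldl (fun d t => braidMove t d) c = c := by
  induction l with
  | nil => rfl
  | cons t l ih =>
    have ht := h t List.mem_cons_self
    rw [List.foldl_cons, braidMove_eq_self ht.1 ht.2]
    exact ih fun s hs => h s (List.mem_cons_of_mem _ hs)

/-- In `lowTriples` and `highTriples` the first two roots are sums ε_a + ε_b, with multiplicity
zero, and such a move is the identity. -/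
theorem transition_eq_diffFold {i : Fin n} (hi : (i : ℕ) + 1 < n) {c : LusztigDatum n}
    (hc : IsLevi c) :
    transition i c = diffFold i ⟨i + 1, hi⟩ (Fin.mk_lt_mk.2 (Nat.lt_succ_self i)) c n := by
  have hfront : toFront i = diffTriples i ⟨i + 1, hi⟩ (Fin.mk_lt_mk.2 (Nat.lt_succ_self i)) ++
      lowTriples i ⟨i + 1, hi⟩ (Fin.mk_lt_mk.2 (Nat.lt_succ_self i)) ++
      highTriples i ⟨i + 1, hi⟩ (Fin.mk_lt_mk.2 (Nat.lt_succ_self i)) := dif_pos hi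
  have hd := foldl_isLevi (i := i) (diffTriples i ⟨i + 1, hi⟩
    (Fin.mk_lt_mk.2 (Nat.lt_succ_self i))) (fun t ht => by rw [hfront]; simp [ht]) hc
  rw [transition, hfront, List.append_assoc, List.foldl_append, foldl_braidMove_eq_self,
    foldl_diffTriples]
  intro t ht
  simp only [List.mem_append, lowTriples, highTriples, List.mem_filterMap] at ht
  rcases ht with ⟨k, -, hk⟩ | ⟨k, -, hk⟩ <;>
  · split_ifs at hk
    obtain rfl := Option.some.inj hk
    exact ⟨hd _, hd _⟩

theorem simpleRoot_of_lt (hn : 2 ≤ n) {i : Fin n} (hi : (i : ℕ) + 1 < n) :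
    simpleRoot hn i = diffRoot i ⟨i + 1, hi⟩ (Fin.mk_lt_mk.2 (Nat.lt_succ_self i)) :=
  dif_pos hi

end Transition

/-! ### Matching the tableau operators with the Lusztig operators -/

namespace BarTableau

variable {n : ℕ} {μ : YoungDiagram}

theorem self_lt_succ {i : Fin n} (hi : (i : ℕ) + 1 < n) : i < ⟨i + 1, hi⟩ :=
  Fin.mk_lt_mk.2 (Nat.lt_succ_self i)

/-- The multiplicity of `α_i` after the braid moves for the rows from `r` downwards, in terms of
the heights of the row reading word. -/
theorem diffFold_tableauDatum (T : BarTableau n μ) {i : Fin n} (hi : (i : ℕ) + 1 < n) {v : ℕ}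
    (hv : v + i + 2 = n) {m : ℕ} (hm : (i : ℕ) + 2 ≤ m) {x : ℕ}
    (hx : diffFold i ⟨i + 1, hi⟩ (self_lt_succ hi) (tableauDatum T) m
      (diffRoot i ⟨i + 1, hi⟩ (self_lt_succ hi)) = x) {r : ℕ} (hr : m + r = n) :
    (∀ k, r ≤ k → k ≤ v → T.rowHeight v k ≤ x + T.rowHeight v r - T.rowCount r (v + 1)) ∧
      ∃ k, r ≤ k ∧ k ≤ v ∧ x + T.rowHeight v r - T.rowCount r (v + 1) = T.rowHeight v k := by
  induction m, hm using Nat.le_induction generalizing r x with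
  | base =>
    obtain rfl : r = v := by omega
    rw [diffFold_of_le _ le_rfl, tableauDatum_diffRoot] at hx
    have e1 : n - 1 - (i + 1) = r := by omega
    have e2 : n - 1 - (i : ℕ) = r + 1 := by omega
    simp only [e1, e2] at hx
    subst hx
    refine ⟨fun k h1 h2 => ?_, r, le_rfl, le_rfl, by ring⟩
    obtain rfl : k = r := by omega
    omega
  | succ m hm ih =>
    obtain ⟨h1, k₀, hk₀, hk₀', h2⟩ := ih rfl (r := r + 1) (by omega)
    have hmn : m < n := by omega
    have hstep := diffFold_succ_apply (hpq := self_lt_succ hi) (tableauDatum T) ⟨m, hmn⟩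
      (show (i : ℕ) + 1 < m by omega)
    rw [hx, tableauDatum_diffRoot, tableauDatum_diffRoot] at hstep
    have e1 : n - 1 - (i + 1) = v := by omega
    have e2 : n - 1 - (i : ℕ) = v + 1 := by omega
    have e3 : n - 1 - m = r := by omega
    simp only [e1, e2, e3] at hstep
    have hsucc := T.rowHeight_succ v r
    refine ⟨fun k hk hkv => ?_, ?_⟩
    · rcases hk.eq_or_lt with rfl | hk
      · omega
      · have := h1 k hk hkv
        omega
    · by_cases hle : T.rowCount r v ≤ diffFold i ⟨i + 1, hi⟩ (self_lt_succ hi)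
        (tableauDatum T) m (diffRoot i ⟨i + 1, hi⟩ (self_lt_succ hi))
      · exact ⟨k₀, by omega, hk₀', by omega⟩
      · exact ⟨r, le_rfl, by omega, by omega⟩

theorem isLevi_tableauDatum (T : BarTableau n μ) : IsLevi (tableauDatum T) := fun _ => rfl

/-- Once row 0 is processed, the correction terms h(0) and N_0(v+1) cancel, and the multiplicity is
the maximum of h over the rows up to `v`. -/
theorem lusztigEps_tableauDatum (hn : 2 ≤ n) (T : BarTableau n μ) {i : Fin n}
    (hi : (i : ℕ) + 1 < n) :
    lusztigEps hn i (tableauDatum T) = unmatchedNeg (T.sign i) (readingCells μ) := by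
  obtain ⟨v, hv⟩ : ∃ v, v + i + 2 = n := ⟨n - 2 - i, by omega⟩
  rw [lusztigEps, transition_eq_diffFold hi T.isLevi_tableauDatum, simpleRoot_of_lt hn hi]
  obtain ⟨h1, k₀, -, -, h2⟩ := T.diffFold_tableauDatum hi hv (m := n) (by omega) rfl (r := 0) rfl
  obtain ⟨r, hr, hle⟩ := T.exists_le_rowHeight hv
  have h3 := T.rowHeight_le hv k₀
  have h4 := h1 r (Nat.zero_le _) hr
  have h5 := T.rowHeight_zero v
  omega

theorem IsRaise.rowCount_of_ne {i : Fin n} {T T' : BarTableau n μ} {r c : ℕ}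
    (h : IsRaise i T T' (r, c)) {k w : ℕ}
    (hkw : k = r → w ≠ T.entry r c ∧ w ≠ T.entry r c + 1) :
    T'.rowCount k w = T.rowCount k w := by
  unfold rowCount
  congr 1
  refine Finset.filter_congr ?_
  rintro ⟨a, b⟩ hx
  rw [YoungDiagram.mem_row_iff] at hx
  obtain rfl : a = k := hx.2
  simp only [h.entry_eq]
  split_ifs with hab
  · obtain ⟨rfl, rfl⟩ := Prod.mk.inj hab
    have := hkw rfl
    omega
  · rfl

theorem IsRaise.rowCount_entry {i : Fin n} {T T' : BarTableau n μ} {r c : ℕ}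
    (h : IsRaise i T T' (r, c)) (hm : (r, c) ∈ μ) :
    T'.rowCount r (T.entry r c) + 1 = T.rowCount r (T.entry r c) := by
  have hins : (μ.row r).filter (fun x => T.entry x.1 x.2 = T.entry r c) =
      insert (r, c) ((μ.row r).filter fun x => T'.entry x.1 x.2 = T.entry r c) := by
    ext ⟨a, b⟩
    simp only [Finset.mem_insert, Finset.mem_filter, YoungDiagram.mem_row_iff, h.entry_eq]
    by_cases hab : (a, b) = (r, c)
    · obtain ⟨rfl, rfl⟩ := Prod.mk.inj hab
      simp [hm]
    · simp [hab]
  unfold rowCount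
  rw [hins, Finset.card_insert_of_notMem]
  simp [h.entry_eq]

theorem IsRaise.rowCount_entry_succ {i : Fin n} {T T' : BarTableau n μ} {r c : ℕ}
    (h : IsRaise i T T' (r, c)) (hm : (r, c) ∈ μ) :
    T'.rowCount r (T.entry r c + 1) = T.rowCount r (T.entry r c + 1) + 1 := by
  have hins : (μ.row r).filter (fun x => T'.entry x.1 x.2 = T.entry r c + 1) =
      insert (r, c) ((μ.row r).filter fun x => T.entry x.1 x.2 = T.entry r c + 1) := by
    ext ⟨a, b⟩
    simp only [Finset.mem_insert, Finset.mem_filter, YoungDiagram.mem_row_iff, h.entry_eq]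
    by_cases hab : (a, b) = (r, c)
    · obtain ⟨rfl, rfl⟩ := Prod.mk.inj hab
      simp [hm]
    · simp [hab]
  unfold rowCount
  rw [hins, Finset.card_insert_of_notMem]
  simp

theorem IsRaise.tableauDatum_eq (hn : 2 ≤ n) {i : Fin n} (hi : (i : ℕ) + 1 < n)
    {T T' : BarTableau n μ} {x : ℕ × ℕ} (h : IsRaise i T T' x) :
    tableauDatum T' = lusztigF hn i (tableauDatum T) := by
  obtain ⟨r, c⟩ := x
  obtain ⟨v, hv⟩ : ∃ v, v + i + 2 = n := ⟨n - 2 - i, by omega⟩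
  obtain ⟨hm, hx, hK, hlt⟩ := h.rowHeight hv
  have hrv : r ≤ v := hx ▸ T.le_entry hm
  have hc1 := h.rowCount_entry hm
  have hc2 := h.rowCount_entry_succ hm
  have hc3 : ∀ k w, (k = r → w ≠ v ∧ w ≠ v + 1) → T'.rowCount k w = T.rowCount k w := by
    intro k w hkw
    exact h.rowCount_of_ne (hx.symm ▸ hkw)
  rw [hx] at hc1 hc2
  have e1 : n - 1 - (i + 1) = v := by omega
  have e2 : n - 1 - (i : ℕ) = v + 1 := by omega
  -- For a row s < r the maximum of h over rows s+1, ..., v is attained at `r` and is at least h(s);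
  -- rewritten, this is N_s(v) ≤ x.
  have hle : ∀ k : Fin n, ∀ hk : (⟨i + 1, hi⟩ : Fin n) < k, n ≤ k + r →
      tableauDatum T (diffRoot ⟨i + 1, hi⟩ k hk) ≤ diffFold i ⟨i + 1, hi⟩ (self_lt_succ hi)
        (tableauDatum T) k (diffRoot i ⟨i + 1, hi⟩ (self_lt_succ hi)) := by
    intro k hk hkr
    have hk2 := k.2
    have hk' : (i : ℕ) + 1 < k := hk
    obtain ⟨s, hs⟩ : ∃ s, (k : ℕ) + (s + 1) = n := ⟨n - 1 - k, by omega⟩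
    have h1 := (T.diffFold_tableauDatum hi hv hk' rfl hs).1 r (by omega) hrv
    have h2 := T.rowHeight_le hv s
    have h3 := T.rowHeight_succ v s
    rw [tableauDatum_diffRoot]
    have e3 : n - 1 - (k : ℕ) = s := by omega
    simp only [e1, e3]
    omega
  have key : diffFold i ⟨i + 1, hi⟩ (self_lt_succ hi) (tableauDatum T') n =
      Function.update (diffFold i ⟨i + 1, hi⟩ (self_lt_succ hi) (tableauDatum T) n)
        (diffRoot i ⟨i + 1, hi⟩ (self_lt_succ hi))
        (diffFold i ⟨i + 1, hi⟩ (self_lt_succ hi) (tableauDatum T) n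
          (diffRoot i ⟨i + 1, hi⟩ (self_lt_succ hi)) + 1) := by
    rcases hrv.eq_or_lt with rfl | hrv
    -- An entry `v` in row `v` is not recorded, so here the datum changes only at the simple root
    -- itself, before any move has acted.
    · refine diffFold_update_of_le (m₀ := i + 2) (Nat.lt_succ_self _) (by omega) le_rfl ?_
        fun k hk hk' => hle k hk (by omega)
      rw [diffFold_of_le _ le_rfl, diffFold_of_le _ le_rfl]
      funext ρ
      by_cases hρ : ρ = diffRoot i ⟨i + 1, hi⟩ (self_lt_succ hi)
      · subst hρ
        rw [Function.update_self, tableauDatum_diffRoot, tableauDatum_diffRoot]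
        simp only [e1, e2]
        exact hc2
      · rw [Function.update_of_ne hρ]
        rcases ρ with ρ | ⟨⟨a, b⟩, hab⟩
        · rfl
        · refine hc3 _ _ ?_
          simp only [Sum.inr.injEq, Subtype.mk.injEq, Prod.mk.injEq, Fin.ext_iff] at hρ
          have hab' : (a : ℕ) < b := hab
          have := b.2
          simp only
          omega
    · have hk : (⟨i + 1, hi⟩ : Fin n) < ⟨n - 1 - r, by omega⟩ := Fin.mk_lt_mk.2 (by omega)
      have e3 : n - 1 - (n - 1 - r) = r := by omega
      -- Row `r` belongs to the move of index n - 1 - r; the extra unit on the simple root appears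
      -- just after it.
      refine diffFold_update_of_le (m₀ := n - 1 - r + 1) (by simp only; omega) (by omega) le_rfl
        ?_ fun k hk hk' => hle k hk (by omega)
      refine diffFold_shift ⟨n - 1 - r, by omega⟩ hk ?_ ?_ ?_ ?_
      · rw [tableauDatum_diffRoot, tableauDatum_diffRoot]
        simp only [e1, e3]
        exact hc1
      · rw [tableauDatum_diffRoot, tableauDatum_diffRoot]
        simp only [e2, e3]
        exact hc2
      · rintro (ρ | ⟨⟨a, b⟩, hab⟩) h1 h2
        · rfl
        · refine hc3 _ _ ?_
          simp only [ne_eq, Sum.inr.injEq, Subtype.mk.injEq, Prod.mk.injEq, Fin.ext_iff] at h1 h2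
          have hab' : (a : ℕ) < b := hab
          have := b.2
          simp only
          omega
      -- The current multiplicity encodes the maximum of h over rows after `r`, which is strictly
      -- below h(r); this is x < N_r(v).
      · obtain ⟨k, hk1, hk2, hk3⟩ := (T.diffFold_tableauDatum hi hv
          (show (i : ℕ) + 2 ≤ n - 1 - r by omega) rfl (show n - 1 - r + (r + 1) = n by omega)).2
        have h1 := hlt k hk1
        have h2 := T.rowHeight_succ v r
        rw [tableauDatum_diffRoot]
        simp only [e1, e3]
        omega
  rw [← transitionInv_transition i (tableauDatum T'), lusztigF, lusztigEps,
    transition_eq_diffFold hi T.isLevi_tableauDatum,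
    transition_eq_diffFold hi T'.isLevi_tableauDatum, simpleRoot_of_lt hn hi]
  exact congrArg _ key

end BarTableau

theorem tableauMap_isCrystalEmbedding {n : ℕ} (hn : 2 ≤ n) (μ : YoungDiagram) :
    IsCrystalEmbedding (tableauCrystal n μ)
      (tensor (leviCrystal hn) (trivialCrystal (shapeWeight n μ))) (tableauMap hn μ) := by
  have hX : (tableauCrystal n μ).IsCrystal := tableauCrystal_isCrystal hn
  have hL := leviCrystal_isCrystal hn
  have hY := tensor_trivial_isCrystal hn hL (shapeWeight n μ)
  have hwt : ∀ T, (tensor (leviCrystal hn) (trivialCrystal (shapeWeight n μ))).wt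
      (tableauMap hn μ T) = (tableauCrystal n μ).wt T := BarTableau.wt_tableauDatum
  have heps : ∀ i T, (tensor (leviCrystal hn) (trivialCrystal (shapeWeight n μ))).ε i
      (tableauMap hn μ T) = (tableauCrystal n μ).ε i T := by
    intro i T
    rw [tensor_trivial_eps]
    change (if (i : ℕ) + 1 < n then ((lusztigEps hn i (tableauDatum T) : ℤ) : WithBot ℤ) else ⊥) =
      if (i : ℕ) + 1 < n then
        ((unmatchedNeg (BarTableau.sign T i) (readingCells μ) : ℤ) : WithBot ℤ) else ⊥
    split_ifs with hi
    · rw [BarTableau.lusztigEps_tableauDatum hn T hi]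
    · rfl
  have hf : ∀ i T T', (tableauCrystal n μ).f i T = some T' →
      (tensor (leviCrystal hn) (trivialCrystal (shapeWeight n μ))).f i (tableauMap hn μ T) =
        some (tableauMap hn μ T') := by
    intro i T T' h
    by_cases hi : (i : ℕ) + 1 < n
    · obtain ⟨x, hx⟩ := (tableauCrystal_f_iff hi T T').1 h
      rw [tensor_trivial_f_iff hL, leviCrystal_f_iff hn hi]
      exact (hx.tableauDatum_eq hn hi).symm
    · have : (tableauCrystal n μ).f i T = none := if_neg hi
      rw [this] at h
      cases h
  refine ⟨?_, hwt, heps, ?_, ?_, hf⟩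
  · intro T T' h
    exact BarTableau.tableauDatum_injective (congrArg (fun b => b.1.1) h)
  · intro i T
    rw [hX.phi_eq, hY.phi_eq, hwt, heps]
  · intro i T T' h
    -- Compatibility with ẽ is compatibility with f̃ read backwards in both crystals.
    exact (hY.f_iff_e i _ _).1 (hf i _ _ ((hX.f_iff_e i _ _).2 h))

end CrystalD

theorem proposition5p4 (n : ℕ) (hn : 4 ≤ n) (μ : YoungDiagram) (hμ : μ.colLen 0 ≤ n) :
    (CrystalD.tableauCrystal n μ).IsCrystal ∧
    (CrystalD.tensor (CrystalD.leviCrystal (le_trans (by norm_num) hn : 2 ≤ n))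
      (CrystalD.trivialCrystal (CrystalD.shapeWeight n μ))).IsCrystal ∧
    CrystalD.IsCrystalEmbedding (CrystalD.tableauCrystal n μ)
      (CrystalD.tensor (CrystalD.leviCrystal (le_trans (by norm_num) hn : 2 ≤ n))
        (CrystalD.trivialCrystal (CrystalD.shapeWeight n μ)))
      (CrystalD.tableauMap (le_trans (by norm_num) hn : 2 ≤ n) μ) :=
  have h2 : 2 ≤ n := le_trans (by norm_num) hn
  ⟨CrystalD.tableauCrystal_isCrystal h2,
    CrystalD.tensor_trivial_isCrystal h2 (CrystalD.leviCrystal_isCrystal h2) _,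
    CrystalD.tableauMap_isCrystalEmbedding h2 μ⟩
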